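/- Let $G$ be a finite simple graph with vertex set $V$, and let $A(G)$ be its adjacency matrix over the two-element field $GF(2)$. The isotropic matroid $M[IAS(G)]$ is the binary matroid represented over $GF(2)$ by the $V\times(V\sqcup V\sqcup V)$ matrix \[ IAS(G)=\begin{pmatrix} I & A(G) & A(G)+I\end{pmatrix}, \] where $I$ is the $V\times V$ identity matrix: its elements are the $3|V|$ columns of $IAS(G)$, distinguished by their labels, and a set of elements is independent if and only if the corresponding family of columns is linearly independent over $GF(2)$. Two matroids are isomorphic if there is a bijection between their ground sets under which independent sets correspond to independent sets in both directions. **Theorem.** Let $G$ and $H$ be finite forests (finite, loopless graphs without cycles, possibly disconnected or empty). Then $G$ and $H$ are isomorphic as graphs if and only if the matroids $M[IAS(G)]$ and $M[IAS(H)]$ are isomorphic. -/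

import Mathlib

/-- The column matroid (vector matroid) of a finite matrix `A` over a field `K`: the ground set is
the set of column labels, and a set of labels is independent exactly when the corresponding family
of columns is linearly independent (so equal columns with distinct labels are parallel). -/
noncomputable def columnMatroid {K m n : Type*} [Field K] [Finite n]
    (A : Matrix m n K) : Matroid n :=
  (IndepMatroid.ofFinite (E := Set.univ) Set.finite_univ
    (fun I => LinearIndepOn K A.col I)
    (linearIndepOn_empty K A.col)
    (fun _ _ hJ hIJ => hJ.mono hIJ)
    (by
      intro I J hI hJ hIJ
      by_contra! h
      have hspan : Submodule.span K (A.col '' J) ≤ Submodule.span K (A.col '' I) := by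
        rw [Submodule.span_le]
        rintro _ ⟨e, heJ, rfl⟩
        by_cases heI : e ∈ I
        · exact Submodule.subset_span ⟨e, heI, rfl⟩
        · by_contra hne
          exact h e heJ heI (hI.insert hne)
      have hfin : ∀ S : Set n, LinearIndepOn K A.col S →
          Module.finrank K (Submodule.span K (A.col '' S)) = S.ncard := by
        intro S hS
        have := Fintype.ofFinite S
        have h1 := finrank_span_eq_card (R := K) (b := fun x : S => A.col x) hS
        rw [Set.image_eq_range, h1, ← Nat.card_eq_fintype_card, Nat.card_coe_set_eq]
      have : Module.Finite K (Submodule.span K (A.col '' I)) :=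
        Module.Finite.span_of_finite K (Set.toFinite _)
      have := Submodule.finrank_mono hspan
      rw [hfin J hJ, hfin I hI] at this
      omega)
    (fun _ _ => Set.subset_univ _)).matroid

@[simp] lemma columnMatroid_ground {K m n : Type*} [Field K] [Finite n] (A : Matrix m n K) :
    (columnMatroid A).E = Set.univ := rfl

@[simp] lemma columnMatroid_indep_iff {K m n : Type*} [Field K] [Finite n] (A : Matrix m n K)
    (I : Set n) : (columnMatroid A).Indep I ↔ LinearIndepOn K A.col I := Iff.rfl

open Classical in
/-- The matrix `IAS(G) = (I | A(G) | A(G) + I)` over the two-element field, where `A(G)` is the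
adjacency matrix of the (loopless) simple graph `G`. Its rows are labelled by `V`; its columns are
labelled by three copies of `V`, one for each block. -/
noncomputable def isotropicMatrix {V : Type*} (G : SimpleGraph V) :
    Matrix V (V ⊕ V ⊕ V) (ZMod 2) :=
  Matrix.fromCols 1 (Matrix.fromCols (G.adjMatrix (ZMod 2)) (G.adjMatrix (ZMod 2) + 1))

/-- The isotropic matroid `M[IAS(G)]` of a finite simple graph `G`. -/
noncomputable def isotropicMatroid {V : Type*} [Finite V] (G : SimpleGraph V) :
    Matroid (V ⊕ V ⊕ V) :=
  columnMatroid (isotropicMatrix G)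

/-- Two matroids are isomorphic if there is a bijection between their ground sets under which
independent sets correspond to independent sets, in both directions. -/
def MatroidIsomorphic {α β : Type*} (M : Matroid α) (N : Matroid β) : Prop :=
  ∃ e : M.E ≃ N.E, ∀ I : Set M.E,
    M.Indep (Subtype.val '' I) ↔ N.Indep (Subtype.val '' (e '' I))

/-! The rank of the columns labelled by a vertex set `X` is `|X|` plus the cut-rank of `X`, the rank
over GF(2) of the adjacency matrix between `X` and its complement. In a forest, cut-rank 0 means
that no edge leaves `X`, and cut-rank at most 1 means that no two disjoint edges leave `X`: two such
edges give a singular 2 × 2 block only if they lie on a 4-cycle. Hence the matroid, once it is known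
which three columns belong to each vertex, determines the relation `SameCuts`
(`noCrossing_iff_rankLE`, `starCut_iff_rankLE`).

A matroid isomorphism need not respect these vertex triples. A binary matroid determines its cycle
space `Z` (`le_of_supportsOnlyZero_iff`), and the vertex triples are vectors of `Z` that are
orthonormal and span `Z` modulo its radical. The images of the triples of one graph form a second
such system for the other. Any two systems are related by a permutation preserving `Z`
(`exists_perm_eq_iff`): distinct triples either share two elements, whose remaining elements are
then parallel and can be swapped, or lie in a 4 × 4 grid without diagonal that can be transposed.
Correcting the isomorphism gives a bijection of vertices that preserves cuts.

Cuts do not determine a forest exactly: a leaf and its neighbour can exchange labels. This is the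
only ambiguity. A leaf of `G` that is not a leaf of `H` has a neighbour that is pendant at it in
`H`, and a transposition repairs this. Once the leaves agree, pendant edges agree and can be deleted
one by one (`nonempty_iso_of_sameCuts`). -/

namespace SimpleGraph

/-! ### Cuts and leaves of forests. -/

variable {V : Type*}

/-- The edge `ab` leaves the vertex set `X`, with `a` inside. -/
def Crosses (G : SimpleGraph V) (X : Set V) (a b : V) : Prop := a ∈ X ∧ b ∉ X ∧ G.Adj a b

/-- No edge leaves the vertex set `X`. -/
def NoCrossing (G : SimpleGraph V) (X : Set V) : Prop := ∀ a b, ¬ G.Crosses X a b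

/-- Any two edges that leave the vertex set `X` share an end. -/
def StarCut (G : SimpleGraph V) (X : Set V) : Prop :=
  ∀ a b c d, G.Crosses X a b → G.Crosses X c d → a = c ∨ b = d

/-- The vertex `v` has `w` as its only neighbour. -/
def IsPendantAt (G : SimpleGraph V) (v w : V) : Prop := G.Adj v w ∧ ∀ x, G.Adj v x → x = w

/-- The vertex `v` has exactly one neighbour. -/
def IsLeaf (G : SimpleGraph V) (v : V) : Prop := ∃ w, G.IsPendantAt v w

/-- Two graphs have the same empty cuts and the same cuts without two disjoint edges. -/
def SameCuts (G H : SimpleGraph V) : Prop :=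
  ∀ X, (G.NoCrossing X ↔ H.NoCrossing X) ∧ (G.StarCut X ↔ H.StarCut X)

lemma SameCuts.symm {G H : SimpleGraph V} (h : G.SameCuts H) : H.SameCuts G :=
  fun X => ⟨(h X).1.symm, (h X).2.symm⟩

lemma SameCuts.trans {G H K : SimpleGraph V} (h : G.SameCuts H) (h' : H.SameCuts K) :
    G.SameCuts K :=
  fun X => ⟨(h X).1.trans (h' X).1, (h X).2.trans (h' X).2⟩

lemma IsAcyclic.not_triangle {G : SimpleGraph V} (hG : G.IsAcyclic) {a b c : V}
    (hab : G.Adj a b) (hbc : G.Adj b c) (hca : G.Adj c a) : False := by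
  classical
  refine hG.cliqueFree (n := 3) le_rfl {a, b, c} ?_
  exact is3Clique_triple_iff.2 ⟨hab, hca.symm, hbc⟩

lemma IsAcyclic.not_square {G : SimpleGraph V} (hG : G.IsAcyclic) {a b c d : V}
    (hab : G.Adj a b) (hbc : G.Adj b c) (hcd : G.Adj c d) (hda : G.Adj d a)
    (hac : a ≠ c) (hbd : b ≠ d) : False := by
  have h1 : (Walk.cons hab (Walk.cons hbc Walk.nil)).IsPath := by
    simp [hab.ne, hbc.ne, hac]
  have h2 : (Walk.cons hda.symm (Walk.cons hcd.symm Walk.nil)).IsPath := by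
    simp [hda.ne', hcd.ne', hac]
  have := Subtype.mk.inj ((hG.subsingleton_path a c).elim ⟨_, h1⟩ ⟨_, h2⟩)
  simp only [Walk.cons.injEq] at this
  exact hbd this.1

lemma IsAcyclic.exists_isLeaf [Finite V] {G : SimpleGraph V} (hG : G.IsAcyclic) {a b : V}
    (hab : G.Adj a b) : ∃ v, G.IsLeaf v := by
  classical
  have : Nonempty V := ⟨a⟩
  obtain ⟨u, v, p, hp, hmax⟩ := Walk.exists_isPath_forall_isPath_length_le_length G
  have h1 := hmax a b (Walk.cons hab Walk.nil) (by simp [hab.ne])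
  have hnil : ¬ p.Nil := by
    intro hn
    have := Walk.length_eq_zero_iff.2 hn
    simp at h1
    omega
  refine ⟨u, p.snd, p.adj_snd hnil, fun x hx => ?_⟩
  refine hG.eq_snd_of_adj_start hp hx ?_
  by_contra hns
  have := hmax x v (Walk.cons hx.symm p) (by simp [hp, hns])
  simp at this

lemma crosses_singleton {G : SimpleGraph V} {v a b : V} :
    G.Crosses {v} a b ↔ a = v ∧ G.Adj v b := by
  constructor
  · rintro ⟨rfl, -, h⟩
    exact ⟨rfl, h⟩
  · rintro ⟨rfl, h⟩
    exact ⟨rfl, h.ne', h⟩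

lemma noCrossing_singleton {G : SimpleGraph V} {v : V} :
    G.NoCrossing {v} ↔ ∀ x, ¬ G.Adj v x := by
  simp only [NoCrossing, crosses_singleton, not_and]
  exact ⟨fun h x => h v x rfl, fun h a b _ => h b⟩

lemma SameCuts.exists_adj {G H : SimpleGraph V} (h : G.SameCuts H) {v x : V} (hx : G.Adj v x) :
    ∃ y, H.Adj v y := by
  by_contra! hc
  exact noCrossing_singleton.1 ((h {v}).1.2 (noCrossing_singleton.2 hc)) x hx

lemma IsPendantAt.starCut {G : SimpleGraph V} {u w : V} (h : G.IsPendantAt u w) :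
    G.StarCut {u, w} := by
  rintro a b c d ⟨ha, hb, hab⟩ ⟨hc, hd, hcd⟩
  left
  simp only [Set.mem_insert_iff, Set.mem_singleton_iff, not_or] at *
  rcases ha with rfl | rfl
  · exact absurd (h.2 _ hab) hb.2
  · rcases hc with rfl | rfl
    · exact absurd (h.2 _ hcd) hd.2
    · rfl

/-- If `w` had a neighbour `d` outside the pair, every edge from `u` leaving the pair would also end
in `d`. Then `u` is a leaf or `u`, `w`, `d` form a triangle. -/
lemma IsAcyclic.isPendantAt_of_starCut {G : SimpleGraph V} (hG : G.IsAcyclic) {u w x y : V}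
    (huw : u ≠ w) (h : G.StarCut {u, w}) (hx : G.Adj u x) (hy : G.Adj w y) (hu : ¬ G.IsLeaf u) :
    G.IsPendantAt w u := by
  have key : ∀ d, G.Adj w d → d = u := by
    intro d hd
    by_contra hdu
    have hb : ∀ b, G.Adj u b → b ≠ w → b = d := fun b hb hbw =>
      (h u b w d ⟨by simp, by simp [hb.ne', hbw], hb⟩
        ⟨by simp, by simp [hd.ne', hdu], hd⟩).resolve_left huw
    by_cases huw' : G.Adj u w
    · refine hu ⟨w, huw', fun b hub => ?_⟩
      by_contra hbw
      obtain rfl := hb b hub hbw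
      exact hG.not_triangle huw' hd hub.symm
    · have hxw : ∀ b, G.Adj u b → b = d := fun b hub => hb b hub fun e => huw' (e ▸ hub)
      exact hu ⟨d, hxw x hx ▸ hx, hxw⟩
  exact ⟨key y hy ▸ hy, key⟩

lemma isPendantAt_of_sameCuts {G H : SimpleGraph V} (hH : H.IsAcyclic) (h : G.SameCuts H)
    {u w : V} (huw : G.IsPendantAt u w) (hu : ¬ H.IsLeaf u) : H.IsPendantAt w u := by
  obtain ⟨x, hx⟩ := h.exists_adj huw.1
  obtain ⟨y, hy⟩ := h.exists_adj huw.1.symm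
  exact hH.isPendantAt_of_starCut huw.1.ne ((h _).2.1 huw.starCut) hx hy hu

lemma noCrossing_pair {G : SimpleGraph V} {u w : V} (h : G.IsPendantAt u w)
    (h' : G.IsPendantAt w u) : G.NoCrossing {u, w} := by
  rintro a b ⟨ha, hb, hab⟩
  simp only [Set.mem_insert_iff, Set.mem_singleton_iff, not_or] at *
  rcases ha with rfl | rfl
  · exact hb.2 (h.2 _ hab)
  · exact hb.1 (h'.2 _ hab)

lemma isPendantAt_of_noCrossing_pair {G : SimpleGraph V} {u w x : V}
    (h : G.NoCrossing {u, w}) (hx : G.Adj u x) : G.IsPendantAt u w := by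
  have key : ∀ y, G.Adj u y → y = w := by
    intro y hy
    by_contra hyw
    exact h u y ⟨by simp, by simp [hy.ne', hyw], hy⟩
  exact ⟨key x hx ▸ hx, key⟩

/-- A pendant vertex keeps its neighbour when the cuts and the leaves are the same. -/
lemma isPendantAt_congr {G H : SimpleGraph V} (hH : H.IsAcyclic) (h : G.SameCuts H)
    (hl : ∀ v, G.IsLeaf v ↔ H.IsLeaf v) {u w : V} (huw : G.IsPendantAt u w) :
    H.IsPendantAt u w := by
  by_cases hw : H.IsLeaf w
  · obtain ⟨z, hz⟩ := (hl w).2 hw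
    obtain rfl := hz.2 u huw.1.symm
    obtain ⟨x, hx⟩ := h.exists_adj huw.1
    exact isPendantAt_of_noCrossing_pair ((h _).1.1 (noCrossing_pair huw hz)) hx
  · obtain ⟨x, hx⟩ := h.exists_adj huw.1
    obtain ⟨y, hy⟩ := h.exists_adj huw.1.symm
    refine hH.isPendantAt_of_starCut huw.1.ne' ?_ hy hx hw
    rw [Set.pair_comm]
    exact (h _).2.1 huw.starCut

/-! ### Deleting a pendant edge. -/

section DeletePendant

variable {G : SimpleGraph V} {u w : V}

-- Without its only edge, `u` is isolated and its side of the cut is irrelevant. Moving it to the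
-- side of `w` keeps the edge `uw` from crossing in `G`.
open Classical in
lemma IsPendantAt.crosses_deleteEdges (h : G.IsPendantAt u w) (X : Set V) (a b : V) :
    (G.deleteEdges {s(u, w)}).Crosses X a b ↔
      G.Crosses (if w ∈ X then insert u X else X \ {u}) a b := by
  have h1 := h.1.ne
  simp only [Crosses, deleteEdges_adj, Set.mem_singleton_iff, Sym2.eq_iff]
  have h2 : ∀ x, G.Adj u x → x = w := h.2
  have h3 : ∀ x, G.Adj x u → x = w := fun x hx => h.2 x hx.symm
  split_ifs with hw <;> simp only [Set.mem_insert_iff, Set.mem_sdiff, Set.mem_singleton_iff] <;>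
  · by_cases hau : a = u
    · subst hau
      have := h2 b
      grind
    · by_cases hbu : b = u
      · subst hbu
        have := h3 a
        grind
      · grind

lemma IsPendantAt.sameCuts_deleteEdges {H : SimpleGraph V} (h : G.IsPendantAt u w)
    (h' : H.IsPendantAt u w) (hc : G.SameCuts H) :
    (G.deleteEdges {s(u, w)}).SameCuts (H.deleteEdges {s(u, w)}) := by
  classical
  intro X
  have := hc (if w ∈ X then insert u X else X \ {u})
  simpa only [NoCrossing, StarCut, h.crosses_deleteEdges, h'.crosses_deleteEdges] using this

lemma IsPendantAt.isLeaf_deleteEdges_iff (h : G.IsPendantAt u w) {v : V} (hv : v ≠ w) :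
    (G.deleteEdges {s(u, w)}).IsLeaf v ↔ G.IsLeaf v ∧ v ≠ u := by
  have h2 : ∀ x, G.Adj u x → x = w := h.2
  by_cases hvu : v = u
  · subst hvu
    simp only [ne_eq, not_true_eq_false, and_false, iff_false]
    rintro ⟨x, hx, -⟩
    rw [deleteEdges_adj] at hx
    exact hx.2 (by rw [h2 x hx.1]; rfl)
  · have : ∀ x, (G.deleteEdges {s(u, w)}).Adj v x ↔ G.Adj v x := by
      intro x
      simp [deleteEdges_adj, hv, hvu]
    simp only [IsLeaf, IsPendantAt, this, ne_eq, hvu, not_false_eq_true, and_true]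

/-- Among the vertices other than `u`, only `w` can change its leaf status when `uw` is deleted.
This lemma makes the leaf hypothesis survive the induction. -/
lemma IsPendantAt.isPendantAt_deleteEdges_imp {H : SimpleGraph V} (hH : H.IsAcyclic)
    (h : G.IsPendantAt u w) (h' : H.IsPendantAt u w) (hc : G.SameCuts H)
    (hl : ∀ v, G.IsLeaf v ↔ H.IsLeaf v) (hw : (G.deleteEdges {s(u, w)}).IsLeaf w) :
    (H.deleteEdges {s(u, w)}).IsLeaf w := by
  by_contra hwH
  obtain ⟨x, hx⟩ := hw
  have hp := isPendantAt_of_sameCuts (hH.anti (deleteEdges_le _))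
    (h.sameCuts_deleteEdges h' hc) hx hwH
  have hxw : x ≠ w := hx.1.ne'
  have hxG : G.IsLeaf x := (hl x).2 (((h'.isLeaf_deleteEdges_iff hxw).1 ⟨w, hp⟩).1)
  have hGwx := hx.1
  rw [deleteEdges_adj] at hGwx
  obtain ⟨z, hz⟩ := hxG
  obtain rfl := hz.2 w hGwx.1.symm
  -- In `H` the vertex `x` is pendant at `w`, so `x` is also a leaf of `G`. Thus `u`, `w`, `x` form
  -- a whole component, an empty cut that `H` shares.
  have hno : G.NoCrossing {w, x, u} := by
    rintro a b ⟨ha, hb, hab⟩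
    simp only [Set.mem_insert_iff, Set.mem_singleton_iff, not_or] at ha hb
    rcases ha with rfl | rfl | rfl
    · refine hb.2.1 (hx.2 b ?_)
      rw [deleteEdges_adj]
      refine ⟨hab, ?_⟩
      simp only [Set.mem_singleton_iff, Sym2.eq_iff]
      grind
    · exact hb.1 (hz.2 _ hab)
    · exact hb.1 (h.2 _ hab)
  have hnoH := (hc _).1.1 hno
  have hpa := hp.1.symm
  refine hwH ⟨x, hpa, fun y hy => ?_⟩
  rw [deleteEdges_adj] at hy
  by_contra hyx
  refine hnoH w y ⟨by simp, ?_, hy.1⟩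
  have := hy.1.ne
  simp only [Set.mem_insert_iff, Set.mem_singleton_iff, not_or]
  refine ⟨this.symm, hyx, ?_⟩
  rintro rfl
  exact hy.2 (Sym2.eq_swap)

end DeletePendant

/-- Forests with the same cuts and the same leaves are equal. -/
theorem eq_of_sameCuts_of_isLeaf_iff [Finite V] (G H : SimpleGraph V) (hG : G.IsAcyclic)
    (hH : H.IsAcyclic) (h : G.SameCuts H) (hl : ∀ v, G.IsLeaf v ↔ H.IsLeaf v) : G = H := by
  induction G using WellFoundedLT.induction generalizing H with
  | ind G ih =>
    by_cases hne : ∃ u, G.IsLeaf u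
    · obtain ⟨u, w, huw⟩ := hne
      have huw' := isPendantAt_congr hH h hl huw
      have hlt : G.deleteEdges {s(u, w)} < G := by
        refine lt_of_le_of_ne (deleteEdges_le _) fun he => ?_
        have := huw.1
        rw [← he, deleteEdges_adj] at this
        exact this.2 rfl
      have := ih _ hlt (H.deleteEdges {s(u, w)}) (hG.anti (deleteEdges_le _))
        (hH.anti (deleteEdges_le _)) (huw.sameCuts_deleteEdges huw' h) (fun v => by
          by_cases hv : v = w
          · subst hv
            exact ⟨huw.isPendantAt_deleteEdges_imp hH huw' h hl,
              huw'.isPendantAt_deleteEdges_imp hG huw h.symm fun v => (hl v).symm⟩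
          · rw [huw.isLeaf_deleteEdges_iff hv, huw'.isLeaf_deleteEdges_iff hv, hl])
      ext a b
      by_cases hab : s(a, b) = s(u, w)
      · rw [← mem_edgeSet, ← mem_edgeSet, hab, mem_edgeSet, mem_edgeSet]
        exact ⟨fun _ => huw'.1, fun _ => huw.1⟩
      · have h2 := congrArg (fun K => K.Adj a b) this
        simpa [deleteEdges_adj, hab] using h2
    · have hb : ∀ K : SimpleGraph V, K.IsAcyclic → (¬ ∃ u, K.IsLeaf u) → K = ⊥ := by
        intro K hK hKl
        ext a b
        simp only [bot_adj, iff_false]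
        exact fun hab => hKl (hK.exists_isLeaf hab)
      rw [hb G hG hne, hb H hH (by simpa only [← hl] using hne)]

/-! ### Exchanging a leaf with its neighbour. -/

section Swap

variable {H : SimpleGraph V} {u w : V}

/-- The edge `uw` crosses, and an edge sharing an end with it contains `u`, since `w` has no other
edge. -/
lemma IsPendantAt.starCut_iff (h : H.IsPendantAt w u) {X : Set V} (hX : ¬ (u ∈ X ↔ w ∈ X)) :
    H.StarCut X ↔ ∀ a b, H.Crosses X a b → a = u ∨ b = u := by
  have h1 : ∀ x, H.Adj w x → x = u := h.2
  have h1' : ∀ x, H.Adj x w → x = u := fun x hx => h.2 x hx.symm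
  constructor
  · intro hs a b hab
    by_cases hu : u ∈ X
    · have hw : w ∉ X := fun hw => hX ⟨fun _ => hw, fun _ => hu⟩
      rcases hs a b u w hab ⟨hu, hw, h.1.symm⟩ with rfl | rfl
      · exact Or.inl rfl
      · exact Or.inl (h1' _ hab.2.2)
    · have hw : w ∈ X := by tauto
      rcases hs a b w u hab ⟨hw, hu, h.1⟩ with rfl | rfl
      · exact Or.inr (h1 _ hab.2.2)
      · exact Or.inr rfl
  · intro hs a b c d hab hcd
    have := hs a b hab
    have := hs c d hcd
    have := hab.1
    have := hab.2.1
    have := hcd.1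
    have := hcd.2.1
    grind

open Classical in
lemma IsPendantAt.sameCuts_swap (h : H.IsPendantAt w u) :
    H.SameCuts (H.comap (Equiv.swap u w)) := by
  intro X
  by_cases hX : u ∈ X ↔ w ∈ X
  · have hs : ∀ a, Equiv.swap u w a ∈ X ↔ a ∈ X := by
      intro a
      rw [Equiv.swap_apply_def]
      split_ifs with h1 h2
      · rw [h1, hX]
      · rw [h2, hX]
      · rfl
    have hcr : ∀ a b, (H.comap (Equiv.swap u w)).Crosses X a b ↔
        H.Crosses X (Equiv.swap u w a) (Equiv.swap u w b) := by
      intro a b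
      simp [Crosses, hs]
    constructor
    · simp only [NoCrossing, hcr]
      refine ⟨fun H a b => H _ _, fun H a b => ?_⟩
      simpa using H (Equiv.swap u w a) (Equiv.swap u w b)
    · simp only [StarCut, hcr]
      refine ⟨fun H a b c d h1 h2 => by simpa using H _ _ _ _ h1 h2, fun H a b c d h1 h2 => ?_⟩
      simpa using H (Equiv.swap u w a) (Equiv.swap u w b) (Equiv.swap u w c)
        (Equiv.swap u w d) (by simpa using h1) (by simpa using h2)
  -- Now `X` separates `u` and `w`. Both graphs contain the edge `uw`, so neither cut is empty. They
  -- agree on edges avoiding `u` and `w`, and only those can violate the criterion of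
  -- `IsPendantAt.starCut_iff`.
  · have h' : (H.comap (Equiv.swap u w)).IsPendantAt u w := by
      refine ⟨by simpa using h.1, fun x hx => ?_⟩
      have := h.2 (Equiv.swap u w x) (by simpa using hx)
      rw [← Equiv.swap_apply_self u w x, this, Equiv.swap_apply_left]
    constructor
    · have hn : ∀ {K : SimpleGraph V}, K.Adj u w → ¬ K.NoCrossing X := by
        intro K hK hno
        by_cases hu : u ∈ X
        · exact hno u w ⟨hu, fun hw => hX ⟨fun _ => hw, fun _ => hu⟩, hK⟩
        · exact hno w u ⟨by tauto, hu, hK.symm⟩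
      simp only [hn h.1.symm, hn h'.1]
    · rw [h.starCut_iff hX, h'.starCut_iff fun e => hX e.symm]
      have h1 : ∀ x, H.Adj w x → x = u := h.2
      have h1' : ∀ x, H.Adj x w → x = u := fun x hx => h.2 x hx.symm
      have h2 : ∀ x, (H.comap (Equiv.swap u w)).Adj u x → x = w := h'.2
      have h2' : ∀ x, (H.comap (Equiv.swap u w)).Adj x u → x = w := fun x hx => h'.2 x hx.symm
      constructor
      · rintro hs a b ⟨ha, hb, hab⟩
        by_contra! hc
        have hau : a ≠ u := fun e => hc.2 (h2 _ (e ▸ hab))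
        have hbu : b ≠ u := fun e => hc.1 (h2' _ (e ▸ hab))
        have := hs a b ⟨ha, hb, by
          simpa [Equiv.swap_apply_of_ne_of_ne, hau, hbu, hc.1, hc.2] using hab⟩
        tauto
      · rintro hs a b ⟨ha, hb, hab⟩
        by_contra! hc
        have haw : a ≠ w := fun e => hc.2 (h1 _ (e ▸ hab))
        have hbw : b ≠ w := fun e => hc.1 (h1' _ (e ▸ hab))
        have := hs a b ⟨ha, hb, by
          simpa [Equiv.swap_apply_of_ne_of_ne, haw, hbw, hc.1, hc.2] using hab⟩
        tauto

end Swap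

lemma isLeaf_comap_iff {W : Type*} {H : SimpleGraph W} (f : V ≃ W) (v : V) :
    (H.comap f).IsLeaf v ↔ H.IsLeaf (f v) := by
  constructor
  · rintro ⟨x, hx, hx'⟩
    refine ⟨f x, hx, fun y hy => ?_⟩
    rw [← hx' (f.symm y) (by simpa using hy), f.apply_symm_apply]
  · rintro ⟨x, hx, hx'⟩
    refine ⟨f.symm x, by simpa using hx, fun y hy => ?_⟩
    rw [← hx' (f y) hy, f.symm_apply_apply]

/-- Forests with the same cuts are isomorphic. -/
theorem nonempty_iso_of_sameCuts [Finite V] (G H : SimpleGraph V) (hG : G.IsAcyclic)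
    (hH : H.IsAcyclic) (h : G.SameCuts H) : Nonempty (G ≃g H) := by
  classical
  induction hn : {v | G.IsLeaf v ∧ ¬ H.IsLeaf v}.ncard using Nat.strong_induction_on
    generalizing H with
  | _ n ih =>
    by_cases hex : ∃ u, G.IsLeaf u ∧ ¬ H.IsLeaf u
    · obtain ⟨u, ⟨w, huw⟩, hu⟩ := hex
      have hwu := isPendantAt_of_sameCuts hH h huw hu
      -- Otherwise `{u, w}` is a component of `G`, hence an empty cut of `H`, and `u` is a leaf of
      -- `H`. So making `w` a non-leaf by the swap creates no new disagreement of the counted kind.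
      have hwG : ¬ G.IsLeaf w := by
        rintro ⟨z, hz⟩
        obtain rfl := hz.2 u huw.1.symm
        obtain ⟨x, hx⟩ := h.exists_adj huw.1
        exact hu ⟨w, isPendantAt_of_noCrossing_pair ((h _).1.1 (noCrossing_pair huw hz)) hx⟩
      obtain ⟨f⟩ := ih _ (by
        rw [← hn]
        refine Set.ncard_lt_ncard (t := {v | G.IsLeaf v ∧ ¬ H.IsLeaf v}) ?_ (Set.toFinite _)
        rw [Set.ssubset_iff_of_subset]
        · refine ⟨u, ⟨⟨w, huw⟩, hu⟩, fun hc => hc.2 ?_⟩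
          rw [isLeaf_comap_iff, Equiv.swap_apply_left]
          exact ⟨u, hwu⟩
        · rintro x ⟨hx, hx'⟩
          refine ⟨hx, ?_⟩
          rw [isLeaf_comap_iff] at hx'
          by_cases hxu : x = u
          · rwa [hxu]
          · rwa [Equiv.swap_apply_of_ne_of_ne hxu (by rintro rfl; exact hwG hx)] at hx')
        (H.comap (Equiv.swap u w)) (hH.of_comap (Equiv.swap u w).toEmbedding)
        (h.trans hwu.sameCuts_swap) rfl
      exact ⟨f.trans (Iso.comap (Equiv.swap u w) H)⟩
    · push Not at hex
      have hl : ∀ v, G.IsLeaf v ↔ H.IsLeaf v := by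
        refine fun v => ⟨hex v, ?_⟩
        rintro ⟨w, hw⟩
        by_contra hv
        have hwv := isPendantAt_of_sameCuts hG h.symm hw hv
        obtain ⟨z, hz⟩ := hex w ⟨v, hwv⟩
        obtain rfl := hz.2 v hw.1.symm
        obtain ⟨x, hx⟩ := h.symm.exists_adj hw.1
        exact hv ⟨w, isPendantAt_of_noCrossing_pair ((h _).1.2 (noCrossing_pair hw hz)) hx⟩
      obtain rfl := eq_of_sameCuts_of_isLeaf_iff G H hG hH h hl
      exact ⟨Iso.refl⟩

end SimpleGraph

/-! ### Two triple systems for one binary space. -/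

section TripleSystem

variable {E V W : Type*}

open Classical in
/-- The indicator vector of a fibre of `t`. -/
noncomputable def fiberVec (t : E → V) (v : V) : E → ZMod 2 := fun x => if t x = v then 1 else 0

/-- The fibre of `t` over `v` is also a fibre of `t'`. -/
def Matched (t : E → V) (t' : E → W) (v : V) : Prop := ∃ w, ∀ x, t x = v ↔ t' x = w

/-- The fibres of `t` are triples that belong to `Z` and span `Z` modulo its radical. -/
structure TripleSystem [Fintype E] (Z : Submodule (ZMod 2) (E → ZMod 2)) (t : E → V) : Prop where
  ncard_fiber : ∀ v, {x | t x = v}.ncard = 3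
  fiberVec_mem : ∀ v, fiberVec t v ∈ Z
  dotProduct_eq_zero : ∀ z ∈ Z, (∀ v, z ⬝ᵥ fiberVec t v = 0) → ∀ z' ∈ Z, z ⬝ᵥ z' = 0

/-- The fibre of `t` over `v` consists of the three distinct elements `a`, `b`, `c`. -/
structure IsFiber (t : E → V) (v : V) (a b c : E) : Prop where
  ne_ab : a ≠ b
  ne_ac : a ≠ c
  ne_bc : b ≠ c
  iff : ∀ x, t x = v ↔ x = a ∨ x = b ∨ x = c

lemma not_matched_of_ne {t : E → V} {t' : E → W} {x y : E} (h : t x = t y) (h' : t' x ≠ t' y) :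
    ¬ Matched t t' (t x) := by
  rintro ⟨w, hw⟩
  exact h' (((hw x).1 rfl).trans ((hw y).1 h.symm).symm)

variable {t : E → V} {t' : E → W} {v : V} {a b c : E}

namespace IsFiber

lemma fst (h : IsFiber t v a b c) : t a = v := (h.iff a).2 (by simp)
lemma snd (h : IsFiber t v a b c) : t b = v := (h.iff b).2 (by simp)
lemma trd (h : IsFiber t v a b c) : t c = v := (h.iff c).2 (by simp)

lemma rotate (h : IsFiber t v a b c) : IsFiber t v b c a :=
  ⟨h.ne_bc, h.ne_ab.symm, h.ne_ac.symm, fun x => by rw [h.iff x]; tauto⟩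

lemma swap (h : IsFiber t v a b c) : IsFiber t v a c b :=
  ⟨h.ne_ac, h.ne_ab, h.ne_bc.symm, fun x => by rw [h.iff x]; tauto⟩

lemma dotProduct [Fintype E] (h : IsFiber t v a b c) (z : E → ZMod 2) :
    z ⬝ᵥ fiberVec t v = z a + z b + z c := by
  classical
  have h1 := h.ne_ab
  have h2 := h.ne_ac
  have h3 := h.ne_bc
  have : ∀ x, z x * fiberVec t v x = if x ∈ ({a, b, c} : Finset E) then z x else 0 := by
    intro x
    simp [fiberVec, h.iff x]
  simp only [_root_.dotProduct, this, Finset.sum_ite_mem, Finset.univ_inter]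
  rw [Finset.sum_insert (by simp [h1, h2]), Finset.sum_insert (by simp [h3]),
    Finset.sum_singleton, add_assoc]

end IsFiber

/-- Swapping two parallel elements. -/
lemma comp_swap_mem [DecidableEq E] {Z : Submodule (ZMod 2) (E → ZMod 2)} {a x : E} (hax : a ≠ x)
    (h : Pi.single a 1 + Pi.single x 1 ∈ Z) {z : E → ZMod 2} (hz : z ∈ Z) :
    z ∘ Equiv.swap a x ∈ Z := by
  have : z ∘ Equiv.swap a x = z + (z a + z x) • (Pi.single a 1 + Pi.single x 1) := by
    ext y
    have h2 : ∀ p q : ZMod 2, q = p + (p + q) := by decide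
    have h3 : ∀ p q : ZMod 2, p = q + (p + q) := by decide
    simp only [Function.comp, Equiv.swap_apply_def]
    split_ifs with h1 h1'
    · subst h1
      simpa [hax] using h2 (z y) (z x)
    · subst h1'
      simpa [hax.symm] using h3 (z a) (z y)
    · simp [h1, h1']
  rw [this]
  exact Z.add_mem hz (Z.smul_mem _ h)

variable [Fintype E] {Z : Submodule (ZMod 2) (E → ZMod 2)}

namespace TripleSystem

lemma exists_isFiber (h : TripleSystem Z t) (a : E) : ∃ b c, IsFiber t (t a) a b c := by
  obtain ⟨x, y, z, hxy, hxz, hyz, he⟩ := Set.ncard_eq_three.1 (h.ncard_fiber (t a))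
  have hf : IsFiber t (t a) x y z := ⟨hxy, hxz, hyz, fun u => by
    simpa using Set.ext_iff.1 he u⟩
  rcases (hf.iff a).1 rfl with rfl | rfl | rfl
  · exact ⟨_, _, hf⟩
  · exact ⟨_, _, hf.rotate⟩
  · exact ⟨_, _, hf.rotate.rotate⟩

lemma exists_isFiber_of_ne (h : TripleSystem Z t) {a b : E} (hab : a ≠ b) (ht : t b = t a) :
    ∃ c, IsFiber t (t a) a b c := by
  obtain ⟨x, y, hf⟩ := h.exists_isFiber a
  rcases (hf.iff b).1 ht with rfl | rfl | rfl
  · exact absurd rfl hab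
  · exact ⟨_, hf⟩
  · exact ⟨_, hf.swap⟩

lemma exists_isFiber' (h : TripleSystem Z t) (v : V) : ∃ a b c, IsFiber t v a b c := by
  obtain ⟨x, y, z, hxy, hxz, hyz, he⟩ := Set.ncard_eq_three.1 (h.ncard_fiber v)
  exact ⟨x, y, z, hxy, hxz, hyz, fun u => by simpa using Set.ext_iff.1 he u⟩

/-- Triples are orthonormal: distinct fibres are disjoint, and 3 is odd. -/
lemma fiberVec_dotProduct (h : TripleSystem Z t) (v w : V) :
    fiberVec t v ⬝ᵥ fiberVec t w = fiberVec id w v := by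
  obtain ⟨a, b, c, hf⟩ := h.exists_isFiber' w
  rw [hf.dotProduct]
  have key : ∀ x, t x = w → fiberVec t v x = fiberVec id w v := by
    rintro x rfl
    by_cases e : t x = v
    · simp [fiberVec, e]
    · simp [fiberVec, e, Ne.symm e]
  rw [key a hf.fst, key b hf.snd, key c hf.trd]
  generalize fiberVec id w v = r
  revert r
  decide

lemma comp_equiv {E' : Type*} [Fintype E'] {Z' : Submodule (ZMod 2) (E' → ZMod 2)}
    (h : TripleSystem Z t) (e : E' ≃ E) (he : ∀ z, z ∈ Z ↔ z ∘ e ∈ Z') :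
    TripleSystem Z' (t ∘ e) where
  ncard_fiber v := by
    rw [← h.ncard_fiber v]
    exact Set.ncard_preimage_of_injective_subset_range (s := {x | t x = v}) e.injective (by simp)
  fiberVec_mem v := (he _).1 (h.fiberVec_mem v)
  dotProduct_eq_zero z hz h0 z' hz' := by
    have key : ∀ (y : E' → ZMod 2) (y' : E → ZMod 2), (y ∘ e.symm) ⬝ᵥ y' = y ⬝ᵥ (y' ∘ e) :=
      fun y y' => comp_equiv_symm_dotProduct y y' e
    have hs : ∀ y ∈ Z', y ∘ e.symm ∈ Z := fun y hy => (he _).2 (by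
      rwa [Function.comp_assoc, Equiv.symm_comp_self, Function.comp_id])
    have := h.dotProduct_eq_zero _ (hs z hz) (fun v => by rw [key]; exact h0 v) _ (hs z' hz')
    rwa [key, Function.comp_assoc, Equiv.symm_comp_self, Function.comp_id] at this

/-- A triple is congruent, modulo the radical, to the sum of the triples of the other system through
its elements. -/
lemma dotProduct_add_eq_zero (h : TripleSystem Z t) (h' : TripleSystem Z t')
    (hf : IsFiber t v a b c) {z : E → ZMod 2} (hz : z ∈ Z) :
    z ⬝ᵥ fiberVec t v + z ⬝ᵥ fiberVec t' (t' a) + z ⬝ᵥ fiberVec t' (t' b) +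
      z ⬝ᵥ fiberVec t' (t' c) = 0 := by
  -- Paired with the `t'`-triple over `w`, the triple `{a, b, c}` and the sum of the three
  -- `t'`-triples both count how many of `a`, `b`, `c` lie over `w`.
  have := h'.dotProduct_eq_zero
    (fiberVec t v + fiberVec t' (t' a) + fiberVec t' (t' b) + fiberVec t' (t' c))
    (Z.add_mem (Z.add_mem (Z.add_mem (h.fiberVec_mem _) (h'.fiberVec_mem _))
      (h'.fiberVec_mem _)) (h'.fiberVec_mem _)) (fun w => by
        rw [add_dotProduct, add_dotProduct, add_dotProduct, h'.fiberVec_dotProduct,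
          h'.fiberVec_dotProduct, h'.fiberVec_dotProduct, dotProduct_comm, hf.dotProduct]
        simp only [fiberVec, id]
        split_ifs <;> decide) z hz
  rw [add_dotProduct, add_dotProduct, add_dotProduct] at this
  simpa only [dotProduct_comm z] using this

/-- If `T = {a, b, c}` meets three triples of the other system and `x` lies in the first of these,
then the triple of `x` meets exactly one of the other two. -/
lemma exists_isFiber_of_eq (h : TripleSystem Z t) (h' : TripleSystem Z t')
    (hN : ∀ x y, x ≠ y → t x = t y → t' x = t' y → Matched t t' (t x))
    (hf : IsFiber t v a b c) (hab : t' a ≠ t' b) (hac : t' a ≠ t' c)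
    (hbc : t' b ≠ t' c) {x : E} (hxa : x ≠ a) (hx : t' x = t' a) :
    ∃ y y', IsFiber t (t x) x y y' ∧ t x ≠ v ∧ (t' y = t' b ∨ t' y = t' c) ∧
      t' y' ≠ t' a ∧ t' y' ≠ t' b ∧ t' y' ≠ t' c := by
  have hv : ¬ Matched t t' v := hf.fst ▸ not_matched_of_ne (hf.fst.trans hf.snd.symm) hab
  have hxv : t x ≠ v := by
    intro e
    have := hN x a hxa (e.trans hf.fst.symm) hx
    exact hv (e ▸ this)
  have hbad : ¬ Matched t t' (t x) := by
    rintro ⟨w, hw⟩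
    have h1 := (hw x).1 rfl
    have h2 := (hw a).2 (hx ▸ h1)
    exact hxv (h2.symm.trans hf.fst)
  obtain ⟨y, y', hxyy⟩ := h.exists_isFiber x
  have hxy : t' x ≠ t' y := fun e => hbad (hN x y hxyy.ne_ab hxyy.snd.symm e)
  have hxy' : t' x ≠ t' y' := fun e => hbad (hN x y' hxyy.ne_ac hxyy.trd.symm e)
  -- The triple of `x` is orthogonal to `{a, b, c}`, so it meets the three `t'`-triples in an even
  -- total. As `x` accounts for one incidence and `y`, `y'` avoid the first triple, exactly one of
  -- `y`, `y'` lies in the other two.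
  have hs := h.dotProduct_add_eq_zero h' hf (h.fiberVec_mem (t x))
  rw [h.fiberVec_dotProduct, dotProduct_comm, hxyy.dotProduct, dotProduct_comm,
    hxyy.dotProduct, dotProduct_comm, hxyy.dotProduct] at hs
  rw [hx] at hxy hxy'
  simp only [fiberVec, id, hx, hxv, hab, hac, hxy.symm, hxy'.symm, if_true, if_false] at hs
  have key : ∀ y : E, (t' y = t' b → t' y ≠ t' c) ∧ (t' y = t' c → t' y ≠ t' b) := fun y =>
    ⟨fun e => e ▸ hbc, fun e => e ▸ hbc.symm⟩
  have hk := (key y).1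
  have hk' := (key y').1
  by_cases h1 : t' y = t' b <;> by_cases h2 : t' y = t' c <;>
    by_cases h1' : t' y' = t' b <;> by_cases h2' : t' y' = t' c <;>
    first
    | exact absurd h2 (hk h1)
    | exact absurd h2' (hk' h1')
    | exact ⟨y, y', hxyy, hxv, by tauto, hxy'.symm, h1', h2'⟩
    | exact ⟨y', y, hxyy.swap, hxv, by tauto, hxy.symm, h1, h2⟩
    | simp only [h1, h2, h1', h2', hbc, hbc.symm, if_true, if_false] at hs
      exact absurd hs (by decide)

end TripleSystem

/-- Transposing a `4 × 4` grid without diagonal, whose rows and columns are triples of the two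
systems. -/
lemma exists_perm_of_grid (h : TripleSystem Z t) (h' : TripleSystem Z t') (r : Fin 4 → V)
    (s : Fin 4 → W) (hr : r.Injective) (hs : s.Injective) (g : Fin 4 → Fin 4 → E)
    (hgr : ∀ i j, i ≠ j → t (g i j) = r i) (hgs : ∀ i j, i ≠ j → t' (g i j) = s j) :
    ∃ α : Equiv.Perm E, (∀ z ∈ Z, z ∘ α ∈ Z) ∧ Function.Involutive α ∧
      (∀ x, α x ≠ x → ¬ Matched t t' (t x)) ∧ ∀ x, t x = r 0 ↔ t' (α x) = s 0 := by
  have hne : ∀ i j k l, i ≠ j → k ≠ l → g i j = g k l → i = k ∧ j = l := by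
    intro i j k l hij hkl e
    refine ⟨hr ?_, hs ?_⟩
    · rw [← hgr i j hij, ← hgr k l hkl, e]
    · rw [← hgs i j hij, ← hgs k l hkl, e]
  have hrow : ∀ i j k l, j ≠ k → j ≠ l → k ≠ l → i ≠ j → i ≠ k → i ≠ l →
      IsFiber t (r i) (g i j) (g i k) (g i l) := by
    intro i j k l hjk hjl hkl hij hik hil
    have hn : ∀ m n, i ≠ m → i ≠ n → m ≠ n → g i m ≠ g i n := fun m n hm hn hmn e =>
      hmn (hne _ _ _ _ hm hn e).2
    obtain ⟨x, hx⟩ := h.exists_isFiber_of_ne (hn j k hij hik hjk)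
      ((hgr i k hik).trans (hgr i j hij).symm)
    rw [hgr i j hij] at hx
    rcases (hx.iff (g i l)).1 (hgr i l hil) with e | e | e
    · exact absurd e.symm (hn _ _ hij hil hjl)
    · exact absurd e.symm (hn _ _ hik hil hkl)
    · rwa [e]
  have hcol : ∀ i j k l, j ≠ k → j ≠ l → k ≠ l → i ≠ j → i ≠ k → i ≠ l →
      IsFiber t' (s i) (g j i) (g k i) (g l i) := by
    intro i j k l hjk hjl hkl hij hik hil
    have hn : ∀ m n, i ≠ m → i ≠ n → m ≠ n → g m i ≠ g n i := fun m n hm hn hmn e =>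
      hmn (hne _ _ _ _ hm.symm hn.symm e).1
    obtain ⟨x, hx⟩ := h'.exists_isFiber_of_ne (hn j k hij hik hjk)
      ((hgs k i hik.symm).trans (hgs j i hij.symm).symm)
    rw [hgs j i hij.symm] at hx
    rcases (hx.iff (g l i)).1 (hgs l i hil.symm) with e | e | e
    · exact absurd e.symm (hn _ _ hij hil hjl)
    · exact absurd e.symm (hn _ _ hik hil hkl)
    · rwa [e]
  let ι : {p : Fin 4 × Fin 4 // p.1 ≠ p.2} ↪ E := ⟨fun p => g p.1.1 p.1.2, fun p q e => by
    have := hne _ _ _ _ p.2 q.2 e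
    exact Subtype.ext (Prod.ext this.1 this.2)⟩
  let τ : Equiv.Perm {p : Fin 4 × Fin 4 // p.1 ≠ p.2} :=
    Function.Involutive.toPerm (fun p => ⟨p.1.swap, p.2.symm⟩) fun p => rfl
  let α := τ.viaEmbedding ι
  have hα : ∀ i j, i ≠ j → α (g i j) = g j i := fun i j hij =>
    Equiv.Perm.viaEmbedding_apply τ ι ⟨(i, j), hij⟩
  have hα' : ∀ x, (∀ i j, i ≠ j → x ≠ g i j) → α x = x := fun x hx =>
    Equiv.Perm.viaEmbedding_apply_of_notMem τ ι x (by
      rintro ⟨p, rfl⟩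
      exact hx _ _ p.2 rfl)
  have hcase : ∀ x, (∃ i j, i ≠ j ∧ x = g i j) ∨ ∀ i j, i ≠ j → x ≠ g i j := by
    intro x
    by_cases hx : ∃ i j, i ≠ j ∧ x = g i j
    · exact Or.inl hx
    · right
      push Not at hx
      exact hx
  have hthree : ∀ i : Fin 4, ∃ j k l, j ≠ k ∧ j ≠ l ∧ k ≠ l ∧ i ≠ j ∧ i ≠ k ∧ i ≠ l := by
    decide
  have hrx : ∀ x i, t x = r i → ∃ j, i ≠ j ∧ x = g i j := by
    intro x i hx
    obtain ⟨j, k, l, h1, h2, h3, h4, h5, h6⟩ := hthree i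
    rcases ((hrow i j k l h1 h2 h3 h4 h5 h6).iff x).1 hx with rfl | rfl | rfl
    exacts [⟨j, h4, rfl⟩, ⟨k, h5, rfl⟩, ⟨l, h6, rfl⟩]
  have hsx : ∀ x i, t' x = s i → ∃ j, j ≠ i ∧ x = g j i := by
    intro x i hx
    obtain ⟨j, k, l, h1, h2, h3, h4, h5, h6⟩ := hthree i
    rcases ((hcol i j k l h1 h2 h3 h4 h5 h6).iff x).1 hx with rfl | rfl | rfl
    exacts [⟨j, h4.symm, rfl⟩, ⟨k, h5.symm, rfl⟩, ⟨l, h6.symm, rfl⟩]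
  refine ⟨α, ?_, ?_, ?_, ?_⟩
  · intro z hz
    -- The change of `z` under transposition, `d i j = z (g i j) + z (g j i)`, is a coboundary:
    -- `hsum` says that `d` vanishes around every triangle, so `d i j = c i + c j` with base point
    -- 0. The transposed vector is therefore `z` plus the row and column triples weighted by `c`.
    let c : Fin 4 → ZMod 2 := fun i => if i = 0 then 0 else z (g 0 i) + z (g i 0)
    have hsum : ∀ i j k l, j ≠ k → j ≠ l → k ≠ l → i ≠ j → i ≠ k → i ≠ l →
        z (g j k) + z (g k j) + (z (g j l) + z (g l j)) + (z (g k l) + z (g l k)) = 0 := by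
      intro i j k l h1 h2 h3 h4 h5 h6
      have hR := hrow i j k l h1 h2 h3 h4 h5 h6
      -- Row `i` is congruent to the sum of columns `j`, `k`, `l`. Its own entries occur twice and
      -- cancel, leaving the triangle on `j`, `k`, `l`.
      have hs' := h.dotProduct_add_eq_zero h' hR hz
      rw [hgs i j h4, hgs i k h5, hgs i l h6, hR.dotProduct,
        (hcol j i k l h5 h6 h3 h4.symm h1 h2).dotProduct,
        (hcol k i j l h4 h6 h2 h5.symm h1.symm h3).dotProduct,
        (hcol l i j k h4 h5 h1 h6.symm h2.symm h3.symm).dotProduct] at hs'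
      have h2' : (2 : ZMod 2) = 0 := rfl
      linear_combination hs' - (z (g i j) + z (g i k) + z (g i l)) * h2'
    have hc : ∀ i j, i ≠ j → z (g j i) = z (g i j) + (c i + c j) := by
      intro i j hij
      have h2' : (2 : ZMod 2) = 0 := rfl
      by_cases hi : i = 0
      · subst hi
        simp only [c, if_true, if_neg hij.symm]
        linear_combination (- z (g 0 j)) * h2'
      · by_cases hj : j = 0
        · subst hj
          simp only [c, if_true, if_neg hij]
          linear_combination (- z (g i 0)) * h2'
        · have : ∀ i j : Fin 4, i ≠ j → i ≠ 0 → j ≠ 0 → ∃ k, k ≠ 0 ∧ k ≠ i ∧ k ≠ j := by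
            decide
          obtain ⟨k, hk0, hki, hkj⟩ := this i j hij hi hj
          have := hsum k 0 i j (Ne.symm hi) (Ne.symm hj) hij hk0 hki hkj
          simp only [c, if_neg hi, if_neg hj]
          linear_combination this - (z (g i j) + z (g 0 i) + z (g i 0) + z (g 0 j) +
            z (g j 0)) * h2'
    have : z ∘ α = z + ∑ i, c i • (fiberVec t (r i) + fiberVec t' (s i)) := by
      ext x
      simp only [Function.comp, Pi.add_apply, Finset.sum_apply, Pi.smul_apply, smul_eq_mul]
      rcases hcase x with ⟨i, j, hij, rfl⟩ | hx
      · rw [hα i j hij, hc i j hij]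
        simp only [fiberVec, hgr i j hij, hgs i j hij, hr.eq_iff, hs.eq_iff, mul_add,
          Finset.sum_add_distrib, mul_ite, mul_one, mul_zero]
        simp
      · have h1 : ∀ i, t x ≠ r i := fun i e => by
          obtain ⟨j, hj, rfl⟩ := hrx x i e
          exact hx _ _ hj rfl
        have h2 : ∀ i, t' x ≠ s i := fun i e => by
          obtain ⟨j, hj, rfl⟩ := hsx x i e
          exact hx _ _ hj rfl
        simp [hα' x hx, fiberVec, h1, h2]
    rw [this]
    exact Z.add_mem hz (Z.sum_mem fun i _ => Z.smul_mem _
      (Z.add_mem (h.fiberVec_mem _) (h'.fiberVec_mem _)))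
  · intro x
    rcases hcase x with ⟨i, j, hij, rfl⟩ | hx
    · rw [hα i j hij, hα j i hij.symm]
    · rw [hα' x hx, hα' x hx]
  · intro x hx
    rcases hcase x with ⟨i, j, hij, rfl⟩ | hx'
    · have : ∀ i j : Fin 4, ∃ k, i ≠ k ∧ j ≠ k := by decide
      obtain ⟨k, hik, hjk⟩ := this i j
      refine not_matched_of_ne (y := g i k) (by rw [hgr i j hij, hgr i k hik]) ?_
      rw [hgs i j hij, hgs i k hik]
      exact hs.ne hjk
    · exact absurd (hα' x hx') hx
  · intro x
    rcases hcase x with ⟨i, j, hij, rfl⟩ | hx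
    · rw [hα i j hij, hgr i j hij, hgs j i hij.symm, hr.eq_iff, hs.eq_iff]
    · rw [hα' x hx]
      constructor
      · intro e
        obtain ⟨j, hj, rfl⟩ := hrx x 0 e
        exact absurd rfl (hx _ _ hj)
      · intro e
        obtain ⟨j, hj, rfl⟩ := hsx x 0 e
        exact absurd rfl (hx _ _ hj)

end TripleSystem

/-! ### Matching the triples one at a time. -/

section TripleSystem

variable {E V W : Type*} {t : E → V} {t' : E → W} [Fintype E]
  {Z : Submodule (ZMod 2) (E → ZMod 2)}

/-- Two triples of different systems that share two elements are exchanged by swapping the other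
two elements, which are parallel. -/
lemma exists_perm_of_two_common (h : TripleSystem Z t) (h' : TripleSystem Z t') {x y : E}
    (hxy : x ≠ y) (ht : t x = t y) (ht' : t' x = t' y) (hm : ¬ Matched t t' (t x)) :
    ∃ α : Equiv.Perm E, (∀ z ∈ Z, z ∘ α ∈ Z) ∧ Function.Involutive α ∧
      (∀ x, α x ≠ x → ¬ Matched t t' (t x)) ∧ Matched t (t' ∘ α) (t x) := by
  classical
  obtain ⟨a, ha⟩ := h.exists_isFiber_of_ne hxy ht.symm
  obtain ⟨b, hb⟩ := h'.exists_isFiber_of_ne hxy ht'.symm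
  have hab : a ≠ b := by
    rintro rfl
    exact hm ⟨t' x, fun u => (ha.iff u).trans (hb.iff u).symm⟩
  have hbx : t b ≠ t x := by
    intro e
    rcases (ha.iff b).1 e with e | e | e
    exacts [hb.ne_ac e.symm, hb.ne_bc e.symm, hab e.symm]
  -- The sum of two triples with two common elements is the pair of remaining elements, so `a` and
  -- `b` are parallel.
  have hmem : (Pi.single a 1 + Pi.single b 1 : E → ZMod 2) ∈ Z := by
    have : (Pi.single a 1 + Pi.single b 1 : E → ZMod 2) =
        fiberVec t (t x) + fiberVec t' (t' x) := by
      have h1 := ha.ne_ac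
      have h2 := ha.ne_bc
      have h3 := hb.ne_ac
      have h4 := hb.ne_bc
      have h11 : (1 + 1 : ZMod 2) = 0 := by decide
      ext u
      simp only [Pi.add_apply, Pi.single_apply, fiberVec, ha.iff u, hb.iff u]
      by_cases hux : u = x
      · subst hux
        simp [h1, h3, h11]
      · by_cases huy : u = y
        · subst huy
          simp [h2, h4, h11]
        · simp [hux, huy]
    rw [this]
    exact Z.add_mem (h.fiberVec_mem _) (h'.fiberVec_mem _)
  refine ⟨Equiv.swap a b, fun z hz => comp_swap_mem hab hmem hz, Equiv.swap_apply_self a b,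
    ?_, t' x, ?_⟩
  · intro u hu
    by_cases hua : u = a
    · subst hua
      rwa [ha.trd]
    · have hub : u = b := by
        by_contra hub
        exact hu (Equiv.swap_apply_of_ne_of_ne hua hub)
      subst hub
      rintro ⟨w, hw⟩
      have h1 := (hw u).1 rfl
      rw [hb.trd] at h1
      exact hbx ((hw x).2 h1).symm
  · intro u
    rw [ha.iff, Function.comp, hb.iff]
    by_cases hua : u = a
    · subst hua
      simp
    · by_cases hub : u = b
      · subst hub
        simp [hua, hab, ha.ne_ac.symm, ha.ne_bc.symm, hb.ne_ac.symm, hb.ne_bc.symm]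
      · rw [Equiv.swap_apply_of_ne_of_ne hua hub]
        tauto

/-- Call the fibres of `t` rows and those of `t'` columns. By `hN`, unmatched rows meet columns in
at most one element. The parity count of `exists_isFiber_of_eq`, with only three places per column,
then completes the given row and column to the grid of `exists_perm_of_grid`. -/
lemma exists_perm_of_fiber (h : TripleSystem Z t) (h' : TripleSystem Z t')
    (hN : ∀ x y, x ≠ y → t x = t y → t' x = t' y → Matched t t' (t x)) {v : V} {p₂ p₃ p₄ : E}
    (hp : IsFiber t v p₂ p₃ p₄) (h23 : t' p₂ ≠ t' p₃) (h24 : t' p₂ ≠ t' p₄)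
    (h34 : t' p₃ ≠ t' p₄) {q y y' r : E} (hq : IsFiber t' (t' p₂) p₂ q r)
    (hy : IsFiber t (t q) q y y') (hqv : t q ≠ v) (hy3 : t' y = t' p₃) (hy2' : t' y' ≠ t' p₂)
    (hy3' : t' y' ≠ t' p₃) (hy4' : t' y' ≠ t' p₄) :
    ∃ α : Equiv.Perm E, (∀ z ∈ Z, z ∘ α ∈ Z) ∧ Function.Involutive α ∧
      (∀ x, α x ≠ x → ¬ Matched t t' (t x)) ∧ Matched t (t' ∘ α) v := by
  obtain ⟨u, u', hu, hrv, huor, hu2', hu3', hu4'⟩ :=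
    h.exists_isFiber_of_eq h' hN hp h23 h24 h34 hq.ne_ac.symm hq.trd
  have hqr : t q ≠ t r := by
    intro e
    have := hN q r hq.ne_bc e (hq.snd.trans hq.trd.symm)
    obtain ⟨w, hw⟩ := this
    have h1 := (hw q).1 rfl
    rw [hq.snd] at h1
    exact hqv (((hw p₂).2 h1).symm.trans hp.fst)
  have hyp : y ≠ p₃ := by
    rintro rfl
    exact hqv (hy.snd.symm.trans hp.snd)
  have hcol2 : ∀ x, t' x = t' p₂ → t x = v ∨ t x = t q ∨ t x = t r := by
    intro x hx
    rcases (hq.iff x).1 hx with rfl | rfl | rfl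
    exacts [Or.inl hp.fst, Or.inr (Or.inl rfl), Or.inr (Or.inr rfl)]
  obtain ⟨s₃, hs₃⟩ := h'.exists_isFiber_of_ne hyp.symm hy3
  -- If `u` were in the column of `p₃`, that column and the column of `p₂` would be filled by the
  -- rows of `p₂`, `q`, `r`. A further element `s` in the column of `p₄` lies in none of these rows,
  -- yet its row must meet one of the two columns.
  have hu4 : t' u = t' p₄ := by
    refine huor.resolve_left fun hu3 => ?_
    obtain ⟨s, s', hs⟩ := h'.exists_isFiber p₄
    obtain ⟨z, z', hz, hsv, hor, -, -, -⟩ := h.exists_isFiber_of_eq h' hN hp.rotate.rotate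
      h24.symm h34.symm h23 hs.ne_ab.symm hs.snd
    have hsq : t s ≠ t q := by
      intro e
      have := hs.snd
      rcases (hy.iff s).1 e with rfl | rfl | rfl
      exacts [h24 (hq.snd.symm.trans this), h34 (hy3.symm.trans this), hy4' this]
    have hsr : t s ≠ t r := by
      intro e
      have := hs.snd
      rcases (hu.iff s).1 e with rfl | rfl | rfl
      exacts [h24 (hq.trd.symm.trans this), h34 (hu3.symm.trans this), hu4' this]
    have hzs := hz.snd
    rcases hor with hz2 | hz3
    · rcases hcol2 z hz2 with e | e | e <;> rw [hzs] at e <;> contradiction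
    · have hus : u = s₃ := by
        rcases (hs₃.iff u).1 hu3 with rfl | rfl | rfl
        exacts [absurd (hu.snd.symm.trans hp.snd) hrv, absurd (hy.snd.symm.trans hu.snd) hqr, rfl]
      rcases (hs₃.iff z).1 hz3 with rfl | rfl | rfl
      · exact hsv (hzs.symm.trans hp.snd)
      · exact hsq (hzs.symm.trans hy.snd)
      · exact hsr (hzs.symm.trans (hus ▸ hu.snd))
  obtain ⟨s₄, c, hs, hsv, hs42, -, -, hc2⟩ := h.exists_isFiber_of_eq h' hN hp.rotate
    h34 h23.symm h24.symm hs₃.ne_ac.symm hs₃.trd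
  have hsq : t s₃ ≠ t q := by
    intro e
    have := hs₃.trd
    rcases (hy.iff s₃).1 e with e | e | e
    exacts [h23 (hq.snd.symm.trans (e ▸ this)), hs₃.ne_bc e.symm, hy3' (e ▸ this)]
  have hsr : t s₃ ≠ t r := by
    intro e
    have := hs₃.trd
    rcases (hu.iff s₃).1 e with e | e | e
    exacts [h23 (hq.trd.symm.trans (e ▸ this)), h34 (this.symm.trans (e ▸ hu4)), hu3' (e ▸ this)]
  have hs4 : t' s₄ = t' p₄ := by
    refine hs42.resolve_right fun hs2 => ?_
    rcases hcol2 s₄ hs2 with e | e | e <;> rw [hs.snd] at e <;> contradiction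
  -- The parity count is now based at the row of `q`: the row of `r` must meet the column of `y` or
  -- of `y'`, and `u` lies in neither. The same argument for `c` makes `y'`, `u'`, `c` the fourth
  -- column.
  have hu'y' : t' u' = t' y' := by
    obtain ⟨z, z', hz, -, hor, -, -, -⟩ := h.exists_isFiber_of_eq h' hN hy
      (by rw [hq.snd, hy3]; exact h23) (by rw [hq.snd]; exact hy2'.symm)
      (by rw [hy3]; exact hy3'.symm) hq.ne_bc.symm (hq.trd.trans hq.snd.symm)
    rcases (hu.iff z).1 hz.snd with e | e | e
    · exact absurd e hz.ne_ab.symm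
    · subst e
      rw [hu4, hy3] at hor
      rcases hor with e | e
      exacts [absurd e h34.symm, absurd e.symm hy4']
    · subst e
      refine hor.resolve_left ?_
      rwa [hy3]
  have hcy' : t' c = t' y' := by
    obtain ⟨z, z', hz, -, hor, -, -, -⟩ := h.exists_isFiber_of_eq h' hN hy.rotate
      (by rw [hy3]; exact hy3'.symm) (by rw [hq.snd, hy3]; exact h23.symm)
      (by rw [hq.snd]; exact hy2') hs₃.ne_bc.symm (hs₃.trd.trans hy3.symm)
    rcases (hs.iff z).1 hz.snd with e | e | e
    · exact absurd e hz.ne_ab.symm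
    · subst e
      rw [hs4, hq.snd] at hor
      rcases hor with e | e
      exacts [absurd e.symm hy4', absurd e.symm h24]
    · subst e
      refine hor.resolve_right ?_
      rwa [hq.snd]
  obtain ⟨α, h1, h2, h3, h4⟩ := exists_perm_of_grid h h' ![v, t q, t r, t s₃]
    ![t' y', t' p₄, t' p₃, t' p₂]
    (by
      intro i j
      fin_cases i <;> fin_cases j <;>
        simp [hqv, hqv.symm, hrv, hrv.symm, hsv, hsv.symm, hqr, hqr.symm, hsq, hsq.symm, hsr,
          hsr.symm])
    (by
      intro i j
      fin_cases i <;> fin_cases j <;>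
        simp [hy2', hy3', hy4', hy2'.symm, hy3'.symm, hy4'.symm, h23, h24, h34, h23.symm,
          h24.symm, h34.symm])
    -- The diagonal entries are fillers, which the grid hypotheses never inspect.
    ![![p₄, p₄, p₃, p₂], ![y', y', y, q], ![u', u, u, r], ![c, s₄, s₃, s₃]]
    (by
      intro i j
      fin_cases i <;> fin_cases j <;>
        simp [hp.fst, hp.snd, hp.trd, hy.snd, hy.trd, hu.snd, hu.trd, hs.snd, hs.trd])
    (by
      intro i j
      fin_cases i <;> fin_cases j <;>
        simp [hy3, hq.snd, hq.trd, hu4, hu'y', hs4, hs₃.trd, hcy'])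
  exact ⟨α, h1, h2, h3, _, h4⟩

theorem exists_perm_matched (h : TripleSystem Z t) (h' : TripleSystem Z t') {v : V}
    (hv : ¬ Matched t t' v) :
    ∃ v, ¬ Matched t t' v ∧ ∃ α : Equiv.Perm E, (∀ z ∈ Z, z ∘ α ∈ Z) ∧ Function.Involutive α ∧
      (∀ x, α x ≠ x → ¬ Matched t t' (t x)) ∧ Matched t (t' ∘ α) v := by
  by_cases hN : ∀ x y, x ≠ y → t x = t y → t' x = t' y → Matched t t' (t x)
  · refine ⟨v, hv, ?_⟩
    obtain ⟨a, b, c, hf⟩ := h.exists_isFiber' v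
    have hne : ∀ x y, x ≠ y → t x = v → t y = v → t' x ≠ t' y := by
      rintro x y hxy rfl hy e
      exact hv (hN x y hxy hy.symm e)
    have hab := hne _ _ hf.ne_ab hf.fst hf.snd
    have hac := hne _ _ hf.ne_ac hf.fst hf.trd
    have hbc := hne _ _ hf.ne_bc hf.snd hf.trd
    obtain ⟨q, r, hq⟩ := h'.exists_isFiber a
    obtain ⟨y, y', hy, hqv, hor, h1, h2, h3⟩ :=
      h.exists_isFiber_of_eq h' hN hf hab hac hbc hq.ne_ab.symm hq.snd
    rcases hor with hy3 | hy4
    · exact exists_perm_of_fiber h h' hN hf hab hac hbc hq hy hqv hy3 h1 h2 h3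
    · exact exists_perm_of_fiber h h' hN hf.swap hac hab hbc.symm hq hy hqv hy4 h1 h3 h2
  · push Not at hN
    obtain ⟨x, y, hxy, ht, ht', hm⟩ := hN
    exact ⟨t x, hm, exists_perm_of_two_common h h' hxy ht ht' hm⟩

/-- Any two triple systems for the same space are related by a symmetry of the space. -/
theorem exists_perm_eq_iff [Finite V] (h : TripleSystem Z t) (h' : TripleSystem Z t') :
    ∃ α : Equiv.Perm E, (∀ z, z ∈ Z ↔ z ∘ α ∈ Z) ∧
      ∀ x y, t x = t y ↔ t' (α x) = t' (α y) := by
  induction hn : {v | ¬ Matched t t' v}.ncard using Nat.strong_induction_on generalizing t' with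
  | _ n ih =>
    by_cases hv : ∃ v, ¬ Matched t t' v
    · obtain ⟨v₀, hv₀⟩ := hv
      obtain ⟨v, hv, α, hZ, hinv, hbad, hmat⟩ := exists_perm_matched h h' hv₀
      have hZ' : ∀ z, z ∈ Z ↔ z ∘ α ∈ Z := fun z => ⟨hZ z, fun hz => by
        have := hZ _ hz
        rwa [Function.comp_assoc, hinv.comp_self, Function.comp_id] at this⟩
      obtain ⟨β, hβ, hβ'⟩ := ih _ (by
        rw [← hn]
        refine Set.ncard_lt_ncard (t := {v | ¬ Matched t t' v}) ?_ (Set.toFinite _)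
        rw [Set.ssubset_iff_of_subset]
        · exact ⟨v, hv, fun hc => hc hmat⟩
        · rintro u hu ⟨w, hw⟩
          refine hu ⟨w, fun x => ?_⟩
          -- Matched triples are fixed pointwise by `α`, so they stay matched while `v` becomes
          -- matched, and the count drops.
          have hfix : ∀ x, t x = u → α x = x := fun x hx => by
            by_contra hne
            exact hbad x hne (hx ▸ ⟨w, hw⟩)
          constructor
          · intro hx
            rw [Function.comp, hfix x hx]
            exact (hw x).1 hx
          · intro hx
            have hαx := (hw _).2 hx
            have := hfix _ hαx
            rw [hinv x] at this
            rwa [← this] at hαx) (h'.comp_equiv α hZ') rfl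
      refine ⟨β.trans α, fun z => ?_, fun x y => hβ' x y⟩
      rw [hZ' z, hβ]
      rfl
    · push Not at hv
      refine ⟨Equiv.refl E, fun z => Iff.rfl, fun x y => ?_⟩
      obtain ⟨w, hw⟩ := hv (t x)
      have h1 := (hw x).1 rfl
      change t x = t y ↔ t' x = t' y
      rw [eq_comm, hw y, h1, eq_comm]

end TripleSystem

/-! ### Binary matroids and their cycle spaces. -/

section CycleSpace

variable {E F m n : Type*}

/-- The set `S` supports no nonzero vector of `Z`. -/
def SupportsOnlyZero (Z : Submodule (ZMod 2) (E → ZMod 2)) (S : Set E) : Prop :=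
  ∀ z ∈ Z, (∀ x, z x ≠ 0 → x ∈ S) → z = 0

lemma linearIndepOn_iff_fun {K M : Type*} [Field K] [AddCommGroup M] [Module K M] [Fintype E]
    (f : E → M) (S : Set E) : LinearIndepOn K f S ↔
      ∀ z : E → K, ∑ x, z x • f x = 0 → (∀ x, z x ≠ 0 → x ∈ S) → z = 0 := by
  classical
  rw [linearIndepOn_iff]
  constructor
  · intro h z hz hS
    have := h (Finsupp.equivFunOnFinite.symm z) (by
      rw [Finsupp.mem_supported]
      intro x hx
      exact hS x (by simpa using hx)) (by
      rw [Finsupp.linearCombination_apply, Finsupp.sum_fintype _ _ (by simp)]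
      simpa using hz)
    ext x
    simpa using DFunLike.congr_fun this x
  · intro h l hl h0
    rw [Finsupp.mem_supported] at hl
    have := h l (by
      rw [← h0, Finsupp.linearCombination_apply, Finsupp.sum_fintype]
      simp) fun x hx => hl (by simpa using hx)
    ext x
    simpa using congrFun this x

/-- Over GF(2) a vector is its support, and every vector of `Z` is a sum of vectors of minimal
support. Minimal supports are the circuits, which the independent sets determine. -/
lemma le_of_supportsOnlyZero_iff [Finite E] {Z Z' : Submodule (ZMod 2) (E → ZMod 2)}
    (h : ∀ S, SupportsOnlyZero Z S ↔ SupportsOnlyZero Z' S) : Z ≤ Z' := by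
  classical
  have heq : ∀ y z : E → ZMod 2, (∀ x, y x ≠ 0 ↔ z x ≠ 0) → y = z := by
    have h2 : ∀ p q : ZMod 2, (p ≠ 0 ↔ q ≠ 0) → p = q := by decide
    exact fun y z hyz => funext fun x => h2 _ _ (hyz x)
  intro z hz
  induction hn : {x | z x ≠ 0}.ncard using Nat.strong_induction_on generalizing z with
  | _ n ih =>
    by_cases hmin : ∃ y ∈ Z, y ≠ 0 ∧ y ≠ z ∧ ∀ x, y x ≠ 0 → z x ≠ 0
    · obtain ⟨y, hy, hy0, hyz, hsub⟩ := hmin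
      obtain ⟨u, hu⟩ : ∃ u, ¬ (y u ≠ 0 ↔ z u ≠ 0) := by
        by_contra! hc
        exact hyz (heq _ _ hc)
      obtain ⟨w, hw⟩ := Function.ne_iff.1 hy0
      have hyu : y u = 0 := by
        by_contra h1
        exact hu ⟨hsub u, fun _ => h1⟩
      have hzu : z u ≠ 0 := fun h1 => hu ⟨hsub u, fun h2 => absurd h1 h2⟩
      have h2 : ∀ p q : ZMod 2, p ≠ 0 → q ≠ 0 → p - q = 0 := by decide
      have h1 := ih _ (show {x | y x ≠ 0}.ncard < n by
        rw [← hn]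
        refine Set.ncard_lt_ncard (t := {x | z x ≠ 0}) ?_ (Set.toFinite _)
        exact (Set.ssubset_iff_of_subset fun x hx => hsub x hx).2 ⟨u, hzu, fun h1 => h1 hyu⟩)
        hy rfl
      have h3 := ih _ (show {x | (z - y) x ≠ 0}.ncard < n by
        rw [← hn]
        refine Set.ncard_lt_ncard (t := {x | z x ≠ 0}) ?_ (Set.toFinite _)
        refine (Set.ssubset_iff_of_subset (s := {x | (z - y) x ≠ 0}) ?_).2
          ⟨w, hsub w hw, fun h1 => h1 (h2 _ _ (hsub w hw) hw)⟩
        intro x hx hz0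
        by_cases hyx : y x = 0
        · exact hx (by simp [hz0, hyx])
        · exact hsub x hyx hz0) (Z.sub_mem hz hy) rfl
      simpa using Z'.add_mem h3 h1
    · push Not at hmin
      by_cases hz0 : z = 0
      · rw [hz0]
        exact Z'.zero_mem
      -- Passing from `Z` to `Z'` and back gives nested supports inside that of `z`. Minimality of
      -- `z` forces all of them to be equal.
      · have hd : ¬ SupportsOnlyZero Z' {x | z x ≠ 0} := by
          rw [← h]
          exact fun hs => hz0 (hs z hz fun x hx => hx)
        simp only [SupportsOnlyZero, not_forall] at hd
        obtain ⟨y', hy', hs', hy0'⟩ := hd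
        have hd : ¬ SupportsOnlyZero Z {x | y' x ≠ 0} := by
          rw [h]
          exact fun hs => hy0' (hs y' hy' fun x hx => hx)
        simp only [SupportsOnlyZero, not_forall] at hd
        obtain ⟨y, hy, hs, hy0⟩ := hd
        have hyz : y = z := by
          by_contra hne
          obtain ⟨x, hx, hx'⟩ := hmin y hy hy0 hne
          exact hs' x (hs x hx) hx'
        have : y' = z := heq _ _ fun x => ⟨hs' x, fun hx => hs x (hyz ▸ hx)⟩
        rwa [← this]

/-- The linear relations between the columns of a matrix. -/
def Matrix.cycleSpace {K : Type*} [Field K] [Fintype n] (A : Matrix m n K) :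
    Submodule K (n → K) := LinearMap.ker A.mulVecLin

lemma Matrix.mem_cycleSpace {K : Type*} [Field K] [Fintype n] {A : Matrix m n K} {z : n → K} :
    z ∈ A.cycleSpace ↔ A.mulVec z = 0 := Iff.rfl

lemma linearIndepOn_col_iff [Fintype n] (A : Matrix m n (ZMod 2)) (S : Set n) :
    LinearIndepOn (ZMod 2) A.col S ↔ SupportsOnlyZero A.cycleSpace S := by
  rw [linearIndepOn_iff_fun]
  have : ∀ z : n → ZMod 2, ∑ x, z x • A.col x = A.mulVec z := by
    intro z
    ext i
    simp [Matrix.mulVec, dotProduct, Finset.sum_apply, Matrix.col, mul_comm]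
  simp only [this]
  rfl

lemma matroidIsomorphic_columnMatroid_iff {K m' n' : Type*} [Field K] [Finite n] [Finite n']
    (A : Matrix m n K) (B : Matrix m' n' K) :
    MatroidIsomorphic (columnMatroid A) (columnMatroid B) ↔
      ∃ e : n ≃ n', ∀ S, LinearIndepOn K A.col S ↔ LinearIndepOn K B.col (e '' S) := by
  constructor
  · rintro ⟨e, he⟩
    refine ⟨⟨fun x => (e ⟨x, trivial⟩).1, fun y => (e.symm ⟨y, trivial⟩).1,
      fun x => congrArg Subtype.val (e.symm_apply_apply _),
      fun y => congrArg Subtype.val (e.apply_symm_apply _)⟩, fun S => ?_⟩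
    have := he (Subtype.val ⁻¹' S)
    rw [columnMatroid_indep_iff, columnMatroid_indep_iff] at this
    convert this using 2
    · ext x
      simp
    · ext x
      simp
  · rintro ⟨e, he⟩
    refine ⟨⟨fun x => ⟨e x.1, trivial⟩, fun y => ⟨e.symm y.1, trivial⟩,
      fun x => Subtype.ext (e.symm_apply_apply x.1),
      fun y => Subtype.ext (e.apply_symm_apply y.1)⟩, fun S => ?_⟩
    rw [columnMatroid_indep_iff, columnMatroid_indep_iff, he, Set.image_image, Set.image_image]
    rfl

lemma mem_cycleSpace_iff_of_linearIndepOn_iff {m' n' : Type*} [Fintype n] [Fintype n']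
    {A : Matrix m n (ZMod 2)} {B : Matrix m' n' (ZMod 2)} (e : n ≃ n')
    (he : ∀ S, LinearIndepOn (ZMod 2) A.col S ↔ LinearIndepOn (ZMod 2) B.col (e '' S))
    (z : n' → ZMod 2) : z ∈ B.cycleSpace ↔ z ∘ e ∈ A.cycleSpace := by
  have key : ∀ S, SupportsOnlyZero A.cycleSpace S ↔
      SupportsOnlyZero (B.cycleSpace.comap (LinearMap.funLeft (ZMod 2) (ZMod 2) e.symm)) S := by
    intro S
    rw [← linearIndepOn_col_iff, he, linearIndepOn_col_iff]
    constructor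
    · intro h y hy hS
      have := h _ hy fun x hx => ⟨e.symm x, hS _ hx, by simp⟩
      ext x
      simpa [LinearMap.funLeft_apply] using congrFun this (e x)
    · intro h y hy hS
      have := h (y ∘ e) (by
        rw [Submodule.mem_comap]
        convert hy using 1
        ext x
        simp [LinearMap.funLeft_apply]) fun x hx => by
          obtain ⟨u, hu, hux⟩ := hS _ hx
          rwa [← e.injective hux]
      ext x
      simpa using congrFun this (e.symm x)
  have heq := le_antisymm (le_of_supportsOnlyZero_iff key)
    (le_of_supportsOnlyZero_iff fun S => (key S).symm)
  rw [heq, Submodule.mem_comap]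
  have : LinearMap.funLeft (ZMod 2) (ZMod 2) e.symm (z ∘ e) = z := by
    ext x
    simp [LinearMap.funLeft_apply]
  rw [this]

/-- Every set inside `S` that supports no nonzero vector of `Z` has at most `k` elements. -/
def RankLE (Z : Submodule (ZMod 2) (E → ZMod 2)) (S : Set E) (k : ℕ) : Prop :=
  ∀ T ⊆ S, SupportsOnlyZero Z T → T.ncard ≤ k

lemma SupportsOnlyZero.preimage {Z : Submodule (ZMod 2) (E → ZMod 2)}
    {Z' : Submodule (ZMod 2) (F → ZMod 2)} (e : E ≃ F) (he : ∀ z, z ∈ Z' ↔ z ∘ e ∈ Z)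
    {S : Set F} (h : SupportsOnlyZero Z' S) : SupportsOnlyZero Z (e ⁻¹' S) := by
  intro z hz hS
  have := h (z ∘ e.symm) ((he _).2 (by
    rwa [Function.comp_assoc, Equiv.symm_comp_self, Function.comp_id]))
    fun x hx => by simpa using hS _ hx
  ext x
  simpa using congrFun this (e x)

lemma RankLE.of_preimage {Z : Submodule (ZMod 2) (E → ZMod 2)}
    {Z' : Submodule (ZMod 2) (F → ZMod 2)} (e : E ≃ F) (he : ∀ z, z ∈ Z' ↔ z ∘ e ∈ Z)
    {S : Set F} {k : ℕ} (h : RankLE Z (e ⁻¹' S) k) : RankLE Z' S k := by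
  intro T hT hZ
  rw [← Set.ncard_preimage_of_injective_subset_range (s := T) e.injective (by simp)]
  exact h _ (Set.preimage_mono hT) (hZ.preimage e he)

lemma rankLE_preimage_iff {Z : Submodule (ZMod 2) (E → ZMod 2)}
    {Z' : Submodule (ZMod 2) (F → ZMod 2)} (e : E ≃ F) (he : ∀ z, z ∈ Z' ↔ z ∘ e ∈ Z)
    {S : Set F} {k : ℕ} : RankLE Z (e ⁻¹' S) k ↔ RankLE Z' S k := by
  refine ⟨RankLE.of_preimage e he, fun h => ?_⟩
  refine RankLE.of_preimage e.symm (fun z => ?_) (by simpa [← Set.preimage_comp] using h)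
  rw [he, Function.comp_assoc, Equiv.symm_comp_self, Function.comp_id]

end CycleSpace

/-! ### Vertex triples and cut-rank in the isotropic matroid. -/

section Graph

variable {V : Type*}

/-- The vertex that labels a column of the matrix `IAS(G)`. -/
def columnVertex : V ⊕ V ⊕ V → V := Sum.elim id (Sum.elim id id)

lemma isFiber_columnVertex (v : V) :
    IsFiber columnVertex v (Sum.inl v) (Sum.inr (Sum.inl v)) (Sum.inr (Sum.inr v)) :=
  ⟨by simp, by simp, by simp, by rintro (x | x | x) <;> simp [columnVertex]⟩

variable [Fintype V] (G : SimpleGraph V)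

open Classical in
lemma mem_cycleSpace_isotropicMatrix {z : V ⊕ V ⊕ V → ZMod 2} :
    z ∈ (isotropicMatrix G).cycleSpace ↔
      ∀ v, z (Sum.inl v) + (G.adjMatrix (ZMod 2)).mulVec (z ∘ Sum.inr ∘ Sum.inl) v +
        (G.adjMatrix (ZMod 2)).mulVec (z ∘ Sum.inr ∘ Sum.inr) v + z (Sum.inr (Sum.inr v)) = 0 := by
  rw [Matrix.mem_cycleSpace, isotropicMatrix, Matrix.fromCols_mulVec, Matrix.fromCols_mulVec,
    Matrix.add_mulVec, Matrix.one_mulVec, Matrix.one_mulVec, funext_iff]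
  simp only [Pi.add_apply, Pi.zero_apply, Function.comp_apply, add_assoc]
  rfl

/-- The radical condition comes from the symmetry of the adjacency matrix `A`. Write `z = (a, b, c)`
and `z' = (a', b', c')` blockwise. Orthogonality to the triples gives `c = a + b`, membership in the
cycle space then gives `A a = b`, and moving `A` across the product with `b' + c'` yields `z ⬝ᵥ z' =
0`. -/
lemma tripleSystem_columnVertex : TripleSystem (isotropicMatrix G).cycleSpace columnVertex where
  ncard_fiber v := by
    have h := isFiber_columnVertex v
    rw [Set.ncard_eq_three]
    exact ⟨_, _, _, h.ne_ab, h.ne_ac, h.ne_bc, Set.ext fun x => by simpa using h.iff x⟩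
  fiberVec_mem v := by
    classical
    rw [mem_cycleSpace_isotropicMatrix]
    intro u
    have h2 : ∀ p q : ZMod 2, p + q + q + p = 0 := by decide
    exact h2 _ _
  dotProduct_eq_zero z hz h0 z' hz' := by
    classical
    have h2 : (2 : ZMod 2) = 0 := rfl
    have h0' : ∀ v, z (Sum.inl v) + z (Sum.inr (Sum.inl v)) + z (Sum.inr (Sum.inr v)) = 0 :=
      fun v => (isFiber_columnVertex v).dotProduct z ▸ h0 v
    have hsum : ∀ (y : V ⊕ V ⊕ V → ZMod 2), y ∈ (isotropicMatrix G).cycleSpace →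
        (G.adjMatrix (ZMod 2)).mulVec (y ∘ Sum.inr ∘ Sum.inl + y ∘ Sum.inr ∘ Sum.inr) =
          y ∘ Sum.inl + y ∘ Sum.inr ∘ Sum.inr := by
      intro y hy
      rw [mem_cycleSpace_isotropicMatrix] at hy
      ext v
      rw [Matrix.mulVec_add]
      simp only [Pi.add_apply, Function.comp_apply]
      linear_combination hy v - (y (Sum.inl v) + y (Sum.inr (Sum.inr v))) * h2
    have hA := hsum z hz
    have hA' := hsum z' hz'
    have hbc : z ∘ Sum.inr ∘ Sum.inl + z ∘ Sum.inr ∘ Sum.inr = z ∘ Sum.inl := by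
      ext v
      simp only [Pi.add_apply, Function.comp_apply]
      linear_combination h0' v - z (Sum.inl v) * h2
    rw [hbc] at hA
    have hsymm : (G.adjMatrix (ZMod 2)).mulVec (z ∘ Sum.inl) ⬝ᵥ
        (z' ∘ Sum.inr ∘ Sum.inl + z' ∘ Sum.inr ∘ Sum.inr) =
        (z ∘ Sum.inl) ⬝ᵥ (z' ∘ Sum.inl + z' ∘ Sum.inr ∘ Sum.inr) := by
      rw [← hA', Matrix.dotProduct_mulVec, ← Matrix.mulVec_transpose,
        SimpleGraph.transpose_adjMatrix]
    rw [hA] at hsymm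
    have hz0 : ∀ v, z (Sum.inr (Sum.inr v)) = z (Sum.inl v) + z (Sum.inr (Sum.inl v)) := fun v => by
      linear_combination h0' v - (z (Sum.inl v) + z (Sum.inr (Sum.inl v))) * h2
    simp only [dotProduct, Fintype.sum_sum_type, Pi.add_apply, Function.comp_apply, hz0] at hsymm ⊢
    rw [← sub_eq_zero, ← Finset.sum_sub_distrib] at hsymm
    rw [← Finset.sum_add_distrib, ← Finset.sum_add_distrib, ← hsymm]
    refine Finset.sum_congr rfl fun v _ => ?_
    linear_combination (z (Sum.inl v) * z' (Sum.inl v) -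
      z (Sum.inl v) * z' (Sum.inr (Sum.inl v))) * h2

/-- A family of independent columns whose size is governed by a cut. -/
lemma supportsOnlyZero_isotropicMatrix {X Y : Set V} [DecidableRel G.Adj]
    (hY : ∀ b : V → ZMod 2, (∀ x, b x ≠ 0 → x ∈ Y) →
      (∀ y ∉ X, ∑ x, (if G.Adj y x then b x else 0) = 0) → b = 0) :
    SupportsOnlyZero (isotropicMatrix G).cycleSpace
      (Sum.inl '' X ∪ Sum.inr '' (Sum.inl '' Y)) := by
  classical
  intro z hz hS
  rw [mem_cycleSpace_isotropicMatrix] at hz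
  have hc : z ∘ Sum.inr ∘ Sum.inr = 0 := by
    ext v
    by_contra hne
    simpa using hS _ hne
  have ha : ∀ v ∉ X, z (Sum.inl v) = 0 := by
    intro v hv
    by_contra hne
    exact hv (by simpa using hS _ hne)
  have hb := hY (z ∘ Sum.inr ∘ Sum.inl) (fun x hx => by simpa using hS _ hx) fun y hy => by
    have := hz y
    rw [hc, Matrix.mulVec_zero, ha y hy,
      show z (Sum.inr (Sum.inr y)) = 0 from congrFun hc y] at this
    simpa [Matrix.mulVec, dotProduct, SimpleGraph.adjMatrix_apply] using this
  ext (v | v | v)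
  · have := hz v
    rw [hc, hb, Matrix.mulVec_zero, show z (Sum.inr (Sum.inr v)) = 0 from congrFun hc v] at this
    simpa using this
  · exact congrFun hb v
  · exact congrFun hc v

lemma RankLE.ncard_add_le {X Y : Set V} [DecidableRel G.Adj] {k : ℕ}
    (h : RankLE (isotropicMatrix G).cycleSpace (columnVertex ⁻¹' X) k) (hYX : Y ⊆ X)
    (hY : ∀ b : V → ZMod 2, (∀ x, b x ≠ 0 → x ∈ Y) →
      (∀ y ∉ X, ∑ x, (if G.Adj y x then b x else 0) = 0) → b = 0) :
    X.ncard + Y.ncard ≤ k := by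
  have := h _ (by
    rintro _ (⟨x, hx, rfl⟩ | ⟨_, ⟨x, hx, rfl⟩, rfl⟩)
    exacts [hx, hYX hx]) (supportsOnlyZero_isotropicMatrix G hY)
  rwa [Set.ncard_union_eq (by
      rw [Set.disjoint_left]
      rintro _ ⟨x, hx, rfl⟩ ⟨_, -, h⟩
      cases h) (Set.toFinite _) (Set.toFinite _),
    Set.ncard_image_of_injective _ Sum.inl_injective,
    Set.ncard_image_of_injective _ Sum.inr_injective,
    Set.ncard_image_of_injective _ Sum.inl_injective] at this

open Classical in
/-- The rank of the columns labelled by `X` is bounded through the part of the adjacency matrix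
that leaves `X`. -/
lemma rankLE_of_mem_span {X : Set V} {D : Set (V → ZMod 2)}
    (hD : ∀ x ∈ X, (fun i => if G.Adj i x then (1 : ZMod 2) else 0) ∈
      Submodule.span (ZMod 2) ((fun x => Pi.single x 1) '' X ∪ D)) :
    RankLE (isotropicMatrix G).cycleSpace (columnVertex ⁻¹' X) (X.ncard + D.ncard) := by
  intro T hT hI
  rw [← linearIndepOn_col_iff] at hI
  have hfin : Module.finrank (ZMod 2) (Submodule.span (ZMod 2) ((isotropicMatrix G).col '' T)) =
      T.ncard := by
    have := Fintype.ofFinite T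
    have h1 := finrank_span_eq_card (R := ZMod 2) (b := fun x : T => (isotropicMatrix G).col x) hI
    rw [Set.image_eq_range, h1, ← Nat.card_eq_fintype_card, Nat.card_coe_set_eq]
  have hle : Submodule.span (ZMod 2) ((isotropicMatrix G).col '' T) ≤
      Submodule.span (ZMod 2) ((fun x => Pi.single x 1) '' X ∪ D) := by
    have h1 : ∀ x ∈ X, (Pi.single x 1 : V → ZMod 2) ∈
        Submodule.span (ZMod 2) ((fun x => Pi.single x 1) '' X ∪ D) := fun x hx =>
      Submodule.subset_span (Or.inl ⟨x, hx, rfl⟩)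
    have e1 : ∀ x, (isotropicMatrix G).col (Sum.inl x) = Pi.single x 1 := by
      intro x
      ext i
      simp [isotropicMatrix, Matrix.col, Matrix.one_apply, Pi.single_apply]
    have e2 : ∀ x, (isotropicMatrix G).col (Sum.inr (Sum.inl x)) =
        fun i => if G.Adj i x then (1 : ZMod 2) else 0 := by
      intro x
      ext i
      simp [isotropicMatrix, Matrix.col, SimpleGraph.adjMatrix_apply]
    have e3 : ∀ x, (isotropicMatrix G).col (Sum.inr (Sum.inr x)) =
        (fun i => if G.Adj i x then (1 : ZMod 2) else 0) + Pi.single x 1 := by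
      intro x
      ext i
      simp [isotropicMatrix, Matrix.col, SimpleGraph.adjMatrix_apply, Matrix.one_apply,
        Pi.single_apply]
    rw [Submodule.span_le]
    rintro _ ⟨x, hx, rfl⟩
    have hxX := hT hx
    rcases x with x | x | x
    · rw [e1]
      exact h1 x hxX
    · rw [e2]
      exact hD x hxX
    · rw [e3]
      exact Submodule.add_mem _ (hD x hxX) (h1 x hxX)
  rw [← hfin]
  refine (Submodule.finrank_mono hle).trans ?_
  refine (finrank_span_le_card _).trans ?_
  rw [← Set.ncard_eq_toFinset_card']
  refine (Set.ncard_union_le _ _).trans ?_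
  exact Nat.add_le_add_right (Set.ncard_image_le (Set.toFinite _)) _

lemma mem_span_single {X : Set V} [DecidableEq V] {f : V → ZMod 2} (hf : ∀ i ∉ X, f i = 0) :
    f ∈ Submodule.span (ZMod 2) ((fun x => (Pi.single x 1 : V → ZMod 2)) '' X) := by
  rw [pi_eq_sum_univ' f]
  refine Submodule.sum_mem _ fun i _ => ?_
  by_cases hi : i ∈ X
  · refine Submodule.smul_mem _ _ (Submodule.subset_span ⟨i, hi, ?_⟩)
    ext j
    simp [Pi.single_apply, eq_comm]
  · simp [hf i hi]

/-- The identity columns over `X` already have rank `|X|`. An edge leaving `X` from `a` makes the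
adjacency column of `a` independent of them. -/
theorem noCrossing_iff_rankLE (X : Set V) :
    G.NoCrossing X ↔ RankLE (isotropicMatrix G).cycleSpace (columnVertex ⁻¹' X) X.ncard := by
  classical
  constructor
  · intro h
    have := rankLE_of_mem_span G (X := X) (D := ∅) fun x hx => by
      rw [Set.union_empty]
      refine mem_span_single fun i hi => ?_
      exact if_neg fun hadj => h x i ⟨hx, hi, hadj.symm⟩
    simpa using this
  · rintro h a b ⟨ha, hb, hab⟩
    have := h.ncard_add_le G (Y := {a}) (by simpa using ha) fun f hf h0 => by
      have h1 := h0 b hb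
      rw [Fintype.sum_eq_single a fun x hx => by
        rw [show f x = 0 by by_contra hne; exact hx (hf x hne), ite_self], if_pos hab.symm] at h1
      ext x
      by_cases hx : x = a
      · rw [hx]
        exact h1
      · by_contra hne
        exact hx (hf x hne)
    simp at this

/-- Crossing edges form a bipartite graph, so pairwise intersecting ones cannot form a triangle and
must have a common end. -/
lemma SimpleGraph.StarCut.exists_center {W : Type*} {G : SimpleGraph W} {X : Set W}
    (h : G.StarCut X) : (∃ c, ∀ a b, G.Crosses X a b → a = c) ∨
      (∃ c, ∀ a b, G.Crosses X a b → b = c) ∨ G.NoCrossing X := by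
  by_cases h0 : G.NoCrossing X
  · exact Or.inr (Or.inr h0)
  · simp only [SimpleGraph.NoCrossing, not_forall, not_not] at h0
    obtain ⟨a, b, hab⟩ := h0
    by_cases h1 : ∀ c d, G.Crosses X c d → c = a
    · exact Or.inl ⟨a, h1⟩
    · push Not at h1
      obtain ⟨c, d, hcd, hca⟩ := h1
      refine Or.inr (Or.inl ⟨b, fun e f hef => ?_⟩)
      obtain rfl := (h c d a b hcd hab).resolve_left hca
      rcases h e f a d hef hab with rfl | h2
      · exact (h e f c d hef hcd).resolve_left (Ne.symm hca)
      · exact h2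

theorem starCut_iff_rankLE (hG : G.IsAcyclic) (X : Set V) :
    G.StarCut X ↔
      RankLE (isotropicMatrix G).cycleSpace (columnVertex ⁻¹' X) (X.ncard + 1) := by
  classical
  constructor
  · intro h
    have key : ∀ y : V → ZMod 2, (∀ x ∈ X, (fun i => if G.Adj i x then (1 : ZMod 2) else 0) ∈
        Submodule.span (ZMod 2) ((fun x => Pi.single x 1) '' X ∪ {y})) →
        RankLE (isotropicMatrix G).cycleSpace (columnVertex ⁻¹' X) (X.ncard + 1) := by
      intro y hy
      simpa using rankLE_of_mem_span G hy
    rcases h.exists_center with ⟨c, hc⟩ | ⟨c, hc⟩ | h0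
    · refine key (fun i => if G.Adj i c then 1 else 0) fun x hx => ?_
      by_cases hxc : x = c
      · rw [hxc]
        exact Submodule.subset_span (Or.inr rfl)
      · refine Submodule.span_mono Set.subset_union_left (mem_span_single fun i hi => ?_)
        exact if_neg fun hadj => hxc (hc x i ⟨hx, hi, hadj.symm⟩)
    -- With a common end outside `X`, the extra generator is the unit vector of `c`. With one
    -- inside, it was the adjacency column of `c`.
    · refine key (Pi.single c 1) fun x hx => ?_
      rw [show (fun x => (Pi.single x 1 : V → ZMod 2)) '' X ∪ {Pi.single c 1} =
        (fun x => (Pi.single x 1 : V → ZMod 2)) '' (X ∪ {c}) by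
          rw [Set.image_union, Set.image_singleton]]
      refine mem_span_single fun i hi => ?_
      refine if_neg fun hadj => hi ?_
      by_contra hi'
      exact hi' (Or.inr (hc x i ⟨hx, fun h => hi (Or.inl h), hadj.symm⟩))
    · intro T hT hI
      exact ((noCrossing_iff_rankLE G X).1 h0 T hT hI).trans (Nat.le_succ _)
  · rintro h a b c d ⟨ha, hb, hab⟩ ⟨hc, hd, hcd⟩
    by_contra! hne
    have := h.ncard_add_le G (Y := {a, c})
      (by rintro x (rfl | rfl) <;> assumption) fun f hf h0 => by
      have hf0 : ∀ x, x ≠ a ∧ x ≠ c → f x = 0 := by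
        intro x hx
        by_contra hne
        rcases hf x hne with h | h
        exacts [hx.1 h, hx.2 h]
      have hsum : ∀ y, ∑ x, (if G.Adj y x then f x else 0) =
          (if G.Adj y a then f a else 0) + (if G.Adj y c then f c else 0) := fun y =>
        Fintype.sum_eq_add a c hne.1 fun x hx => by rw [hf0 x hx, ite_self]
      have h1 := h0 b hb
      have h2 := h0 d hd
      rw [hsum, if_pos hab.symm] at h1
      rw [hsum, if_pos hcd.symm] at h2
      -- Rows `b`, `d` and columns `a`, `c` have ones at `ba` and `dc`. The other two entries are
      -- not both 1, by the absence of 4-cycles, so the block is triangular and invertible.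
      have h3 : f a = 0 ∧ f c = 0 := by
        by_cases hbc : G.Adj b c
        · have hda : ¬ G.Adj d a := fun hda =>
            hG.not_square hab hbc hcd hda hne.1 hne.2
          rw [if_neg hda, zero_add] at h2
          rw [h2] at h1
          exact ⟨by simpa using h1, h2⟩
        · rw [if_neg hbc, add_zero] at h1
          rw [h1] at h2
          exact ⟨h1, by simpa using h2⟩
      ext x
      by_cases hxa : x = a
      · rw [hxa]
        exact h3.1
      · by_cases hxc : x = c
        · rw [hxc]
          exact h3.2
        · exact hf0 x ⟨hxa, hxc⟩
    rw [Set.ncard_pair hne.1] at this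
    omega

end Graph

/-! ### From matroid isomorphism to graph isomorphism. -/

lemma noCrossing_comap_iff {V W : Type*} (H : SimpleGraph W) (σ : V ≃ W) (X : Set V) :
    (H.comap σ).NoCrossing X ↔ H.NoCrossing (σ '' X) := by
  have key : ∀ a b, (H.comap σ).Crosses X a b ↔ H.Crosses (σ '' X) (σ a) (σ b) := by
    simp [SimpleGraph.Crosses]
  constructor
  · intro h a b hab
    exact h (σ.symm a) (σ.symm b) ((key _ _).2 (by simpa using hab))
  · intro h a b hab
    exact h _ _ ((key _ _).1 hab)

lemma starCut_comap_iff {V W : Type*} (H : SimpleGraph W) (σ : V ≃ W) (X : Set V) :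
    (H.comap σ).StarCut X ↔ H.StarCut (σ '' X) := by
  have : ∀ a b, (H.comap σ).Crosses X a b ↔ H.Crosses (σ '' X) (σ a) (σ b) := by
    simp [SimpleGraph.Crosses]
  constructor
  · intro h a b c d hab hcd
    have := h (σ.symm a) (σ.symm b) (σ.symm c) (σ.symm d) ((this _ _).2 (by simpa using hab))
      ((this _ _).2 (by simpa using hcd))
    simpa using this
  · intro h a b c d hab hcd
    simpa using h _ _ _ _ ((this _ _).1 hab) ((this _ _).1 hcd)

/-- A bijection of the columns that preserves the linear relations yields a bijection of the
vertices that preserves the cuts. -/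
theorem exists_equiv_sameCuts {V W : Type*} [Fintype V] [Fintype W] (G : SimpleGraph V)
    (H : SimpleGraph W) (hG : G.IsAcyclic) (hH : H.IsAcyclic) (e : V ⊕ V ⊕ V ≃ W ⊕ W ⊕ W)
    (he : ∀ z, z ∈ (isotropicMatrix H).cycleSpace ↔ z ∘ e ∈ (isotropicMatrix G).cycleSpace) :
    ∃ σ : V ≃ W, G.SameCuts (H.comap σ) := by
  -- The two systems on the columns of `G` are its own triples and the triples of `H` pulled back
  -- along `e`. Composing `e` with the symmetry `α` sends vertex triples to vertex triples.
  obtain ⟨α, hα, hfib⟩ := exists_perm_eq_iff (tripleSystem_columnVertex G)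
    ((tripleSystem_columnVertex H).comp_equiv e he)
  set e' : V ⊕ V ⊕ V ≃ W ⊕ W ⊕ W := α.trans e with he'
  have heα : ∀ z, z ∈ (isotropicMatrix H).cycleSpace ↔ z ∘ e' ∈ (isotropicMatrix G).cycleSpace := by
    intro z
    rw [he, hα]
    rfl
  have hfib' : ∀ x y, columnVertex x = columnVertex y ↔ columnVertex (e' x) = columnVertex (e' y) :=
    hfib
  have hs : ∀ x, columnVertex (e' (Sum.inl (columnVertex x))) = columnVertex (e' x) := fun x =>
    (hfib' _ _).1 rfl
  let σ : V ≃ W := Equiv.ofBijective (fun v => columnVertex (e' (Sum.inl v))) (by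
    constructor
    · exact fun u v h => (hfib' _ _).2 h
    · intro w
      refine ⟨columnVertex (e'.symm (Sum.inl w)), ?_⟩
      simp only [hs, Equiv.apply_symm_apply]
      rfl)
  have hσ : ∀ X : Set V, e' ⁻¹' (columnVertex ⁻¹' (σ '' X)) = columnVertex ⁻¹' X := by
    intro X
    ext x
    simp only [Set.mem_preimage]
    rw [show columnVertex (e' x) = σ (columnVertex x) from (hs x).symm]
    simp
  refine ⟨σ, fun X => ⟨?_, ?_⟩⟩
  · rw [noCrossing_comap_iff, noCrossing_iff_rankLE, noCrossing_iff_rankLE,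
      Set.ncard_image_of_injective _ σ.injective, ← rankLE_preimage_iff e' heα, hσ]
  · rw [starCut_comap_iff, starCut_iff_rankLE G hG, starCut_iff_rankLE H hH,
      Set.ncard_image_of_injective _ σ.injective, ← rankLE_preimage_iff e' heα, hσ]

lemma linearIndepOn_isotropicMatrix_iso {V W : Type*} {G : SimpleGraph V} {H : SimpleGraph W}
    (f : G ≃g H) (S : Set (V ⊕ V ⊕ V)) :
    LinearIndepOn (ZMod 2) (isotropicMatrix G).col S ↔
      LinearIndepOn (ZMod 2) (isotropicMatrix H).col
        (Equiv.sumCongr f.toEquiv (Equiv.sumCongr f.toEquiv f.toEquiv) '' S) := by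
  classical
  set e := Equiv.sumCongr f.toEquiv (Equiv.sumCongr f.toEquiv f.toEquiv) with he
  -- Relabelling columns by `f` has the same effect as relabelling rows, which is a linear
  -- isomorphism and preserves independence.
  have hcol : (isotropicMatrix H).col ∘ e =
      (LinearEquiv.funCongrLeft (ZMod 2) (ZMod 2) f.toEquiv.symm) ∘ (isotropicMatrix G).col := by
    ext x w
    obtain ⟨v, rfl⟩ := f.surjective w
    have hL : ∀ (y : V → ZMod 2), LinearEquiv.funCongrLeft (ZMod 2) (ZMod 2) f.toEquiv.symm y
        (f v) = y v := fun y => congrArg y (f.symm_apply_apply v)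
    rw [Function.comp_apply, Function.comp_apply, hL]
    have hadj : ∀ x, H.Adj (f v) (f x) ↔ G.Adj v x := fun x => f.map_adj_iff
    rcases x with x | x | x <;> by_cases hx : G.Adj v x <;>
      simp [he, isotropicMatrix, Matrix.col, Matrix.one_apply, SimpleGraph.adjMatrix_apply,
        hx, hadj]
  rw [← linearIndepOn_equiv e, hcol]
  exact (LinearMap.linearIndepOn_iff_of_injOn _ (LinearEquiv.injective _).injOn).symm

theorem mainTheorem3 {V W : Type*} [Finite V] [Finite W]
    (G : SimpleGraph V) (H : SimpleGraph W) (hG : G.IsAcyclic) (hH : H.IsAcyclic) :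
    Nonempty (G ≃g H) ↔ MatroidIsomorphic (isotropicMatroid G) (isotropicMatroid H) := by
  have := Fintype.ofFinite V
  have := Fintype.ofFinite W
  rw [isotropicMatroid, isotropicMatroid, matroidIsomorphic_columnMatroid_iff]
  constructor
  · rintro ⟨f⟩
    exact ⟨_, linearIndepOn_isotropicMatrix_iso f⟩
  · rintro ⟨e, he⟩
    obtain ⟨σ, hσ⟩ := exists_equiv_sameCuts G H hG hH e
      (mem_cycleSpace_iff_of_linearIndepOn_iff e he)
    obtain ⟨f⟩ := SimpleGraph.nonempty_iso_of_sameCuts G (H.comap σ) hG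
      (hH.of_comap σ.toEmbedding) hσ
    exact ⟨f.trans (SimpleGraph.Iso.comap σ H)⟩
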